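/- Let $h:\mathbb{R}^m\to[-\infty,+\infty]$ and $c:\mathbb{R}^n\to\mathbb{R}^m$, let $\bar x\in\mathbb{R}^n$ and $\bar c=c(\bar x)$, and let $|\cdot|$ be the Euclidean norm. For an extended-real-valued function $f$ finite at $z$, the subdifferential $\partial f(z)$ is the set of limits of vectors $v_k$ such that, for some points $z_k\to z$ with $f(z_k)\to f(z)$, $f$ is finite at $z_k$ and $f(z')\ge f(z_k)+\langle v_k,z'-z_k\rangle-o(|z'-z_k|)$ as $z'\to z_k$; where $f$ is not finite, $\partial f$ is empty. The function $h$ is prox-regular at $\bar c$ if $h(\bar c)$ is finite and every point of $\mathbb{R}^m\times\mathbb{R}$ near $(\bar c,h(\bar c))$ has a unique nearest point (in the Euclidean distance) in the epigraph $\{(z,t): t\ge h(z)\}$. For a nonempty set $S$, $\operatorname{par}S$ denotes the subspace parallel to the affine span of $S$. For $x,d\in\mathbb{R}^n$ and $\mu\in\mathbb{R}$ put $$h_{x,\mu}(d)=h\big(c(x)+\nabla c(x)d\big)+\tfrac{\mu}{2}|d|^2 .$$ **Theorem (unique step).** Suppose that $c$ is $C^2$ around $\bar x$, that $h$ is prox-regular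 at $\bar c$, that $h\circ c$ is critical at $\bar x$, i.e. $0\in\partial(h\circ c)(\bar x)$, that $\partial h(\bar c)\neq\emptyset$, and that $$\operatorname{par}\partial h(\bar c)\cap\operatorname{Null}(\nabla c(\bar x)^*)=\{0\}.$$ Then there is exactly one vector $\bar v\in\partial h(\bar c)\cap\operatorname{Null}(\nabla c(\bar x)^*)$, and there exists $\hat\mu\ge 0$ with the following property. $(\ast)$ Given any sequence $\mu_r$ with $\mu_r>\hat\mu$ for all $r$ and any sequence $x_r\to\bar x$ with $\mu_r|x_r-\bar x|\to 0$, there are sequences $d_r\in\mathbb{R}^n$ and $v_r\in\mathbb{R}^m$ such that, for all sufficiently large $r$, $d_r$ is a local minimizer of $h_{x_r,\mu_r}$, $$0\in\partial h_{x_r,\mu_r}(d_r),\qquad \nabla c(x_r)^*v_r+\mu_rd_r=0,\qquad v_r\in\partial h\big(c(x_r)+\nabla c(x_r)d_r\big),$$ and, as $r\to\infty$, $$d_r=O(|x_r-\bar x|),\qquad h\big(c(x_r)+\nabla c(x_r)d_r\big)\to h(\bar c),\qquad v_r\to\bar v .$$ Moreover $d_r$ is uniquely determined for all large $r$: if a sequence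 $d_r'$ also satisfies $0\in\partial h_{x_r,\mu_r}(d_r')$ for all large $r$, $d_r'=O(|x_r-\bar x|)$ and $h(c(x_r)+\nabla c(x_r)d_r')\to h(\bar c)$, then $d_r'=d_r$ for all large $r$. If, in addition, $h$ takes values in $(-\infty,+\infty]$ and is convex and lower semicontinuous, then property $(\ast)$ holds for every $\hat\mu>0$; that is, it holds for all sequences $\mu_r>0$ that are bounded away from $0$. -/

import Mathlib

open Filter Topology Asymptotics

noncomputable section

namespace ProxLin

/-- Euclidean space of dimension `k`. -/
abbrev Euc (k : ℕ) : Type := EuclideanSpace ℝ (Fin k)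

/-- Regular (Fréchet) subgradients of an extended-real-valued function at a point where it is
finite: `h z' ≥ h z + ⟪v, z' - z⟫ - o(|z' - z|)` as `z' → z`. -/
def regularSubdiff {k : ℕ} (h : Euc k → EReal) (z : Euc k) : Set (Euc k) :=
  {v | h z ≠ ⊤ ∧ h z ≠ ⊥ ∧ ∀ ε : ℝ, 0 < ε → ∀ᶠ z' in 𝓝 z,
    h z + ((inner ℝ v (z' - z) - ε * ‖z' - z‖ : ℝ) : EReal) ≤ h z'}

/-- The (limiting, Mordukhovich) subdifferential `∂h(z)`: limits of regular subgradients `v_k` at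
points `z_k → z` with `h(z_k) → h(z)`. It is empty where `h` is not finite. -/
def subdiff {k : ℕ} (h : Euc k → EReal) (z : Euc k) : Set (Euc k) :=
  {v | h z ≠ ⊤ ∧ h z ≠ ⊥ ∧ ∃ (zs vs : ℕ → Euc k),
    Tendsto zs atTop (𝓝 z) ∧ Tendsto (fun j => h (zs j)) atTop (𝓝 (h z)) ∧
    (∀ j, vs j ∈ regularSubdiff h (zs j)) ∧ Tendsto vs atTop (𝓝 v)}

/-- The epigraph of `h`, in `ℝ^k × ℝ` with its Euclidean norm. -/
def epigraph {k : ℕ} (h : Euc k → EReal) : Set (WithLp 2 (Euc k × ℝ)) :=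
  {p | h p.fst ≤ (p.snd : EReal)}

/-- A set is prox-regular at one of its points `s` if every point near `s` has a unique nearest
point in the set. -/
def SetProxRegularAt {X : Type*} [MetricSpace X] (S : Set X) (s : X) : Prop :=
  s ∈ S ∧ ∀ᶠ y in 𝓝 s, ∃! p, p ∈ S ∧ ∀ q ∈ S, dist y p ≤ dist y q

/-- A function is prox-regular at `z` if it is finite there and its epigraph is prox-regular at
`(z, h z)`. -/
def ProxRegularAt {k : ℕ} (h : Euc k → EReal) (z : Euc k) : Prop :=
  h z ≠ ⊤ ∧ h z ≠ ⊥ ∧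
    SetProxRegularAt (epigraph h) (WithLp.toLp 2 (z, (h z).toReal))

/-- The adjoint `∇c(x)^*` of the derivative of `c` at `x`. -/
def adjDeriv {n m : ℕ} (c : Euc n → Euc m) (x : Euc n) : Euc m →L[ℝ] Euc n :=
  ContinuousLinearMap.adjoint (fderiv ℝ c x)

/-- The subspace `par S` parallel to the affine span of a (nonempty) set. -/
def par {k : ℕ} (S : Set (Euc k)) : Submodule ℝ (Euc k) :=
  (affineSpan ℝ S).direction

/-- The linearization `c(x) + ∇c(x) d`. -/
def linearization {n m : ℕ} (c : Euc n → Euc m) (x d : Euc n) : Euc m :=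
  c x + fderiv ℝ c x d

/-- The proximal linearized objective `h_{x,μ}(d) = h(c(x) + ∇c(x) d) + (μ/2) |d|²`. -/
def proxObjective {n m : ℕ} (h : Euc m → EReal) (c : Euc n → Euc m) (x : Euc n) (μ : ℝ)
    (d : Euc n) : EReal :=
  h (linearization c x d) + ((μ / 2 * ‖d‖ ^ 2 : ℝ) : EReal)

/-- Sequences of steps that are eventually critical for the subproblems, of size `O(|x_r - x̄|)`,
and along which `h(c(x_r) + ∇c(x_r) d_r) → h(c(x̄))`. -/
def IsCriticalStepSeq {n m : ℕ} (h : Euc m → EReal) (c : Euc n → Euc m) (xbar : Euc n)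
    (μ : ℕ → ℝ) (x d : ℕ → Euc n) : Prop :=
  (∀ᶠ r in atTop, (0 : Euc n) ∈ subdiff (proxObjective h c (x r) (μ r)) (d r)) ∧
  (d =O[atTop] fun r => x r - xbar) ∧
  Tendsto (fun r => h (linearization c (x r) (d r))) atTop (𝓝 (h (c xbar)))

/-- The unique step property with threshold `μhat` and limiting multiplier `vbar`. -/
def UniqueStepProperty {n m : ℕ} (h : Euc m → EReal) (c : Euc n → Euc m) (xbar : Euc n)
    (vbar : Euc m) (μhat : ℝ) : Prop :=
  ∀ (μ : ℕ → ℝ) (x : ℕ → Euc n),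
    (∀ r, μhat < μ r) → Tendsto x atTop (𝓝 xbar) →
    Tendsto (fun r => μ r * ‖x r - xbar‖) atTop (𝓝 0) →
    ∃ (d : ℕ → Euc n) (v : ℕ → Euc m),
      (∀ᶠ r in atTop, IsLocalMin (proxObjective h c (x r) (μ r)) (d r)) ∧
      IsCriticalStepSeq h c xbar μ x d ∧
      (∀ᶠ r in atTop, adjDeriv c (x r) (v r) + μ r • d r = 0 ∧
        v r ∈ subdiff h (linearization c (x r) (d r))) ∧
      Tendsto v atTop (𝓝 vbar) ∧
      ∀ d' : ℕ → Euc n, IsCriticalStepSeq h c xbar μ x d' → ∀ᶠ r in atTop, d' r = d r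

end ProxLin

end

/-! Prox-regularity enters through one inequality. If points near `s` have unique nearest points in
`S`, a nearest point stays nearest when one moves outward along the normal, up to a radius
independent of the point. Regular normals are limits of such proximal normals, so they satisfy a
uniform quadratic inequality (`SetProxRegularAt.exists_normal_bound`). Applied to the normals `(v,
-1)` of the epigraph, and with `h` replaced near `c xbar` by a real-valued truncation `φ = min h β`
(`ProxRegularAt.exists_truncation`), this bounds the failure of the subgradient inequality by `K (1
+ ‖v‖) (‖z' - z‖² + (φ z' - φ z)²)`. For `‖v‖ ≤ V` the last square is absorbed, leaving a support
inequality with a fixed curvature `ρ` (`IsProxTruncation.exists_quadSupport`). In the convex case `ρ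
= 0`.

Multipliers are controlled by compactness. If approximate multipliers blew up, their normalized
limit `w` could be added to a subgradient at `c xbar` (`IsProxTruncation.add_mem_realSubdiff`); then
`w` would be a nonzero element of the parallel subspace killed by the adjoint derivative, which
transversality forbids. Hence approximate multipliers are bounded
(`IsProxTruncation.exists_multiplier_bound`). Boundedness upgrades a fuzzy chain rule to an exact
one, which gives existence of `vbar`; transversality gives its uniqueness, and the two together
force convergence of multipliers (`multiplier_close`).

A step is found by exact penalization (`exists_local_min_step`): over a small compact set minimize
`φ z + μ/2 ‖d‖² + α ‖z - (c x + ∇c(x) d)‖`. The step `p = xbar - x` misses `c xbar` by only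
`O(‖p‖²)`, and comparing with it gives `‖d‖ = O(‖p‖)` with a constant independent of `μ`. If the
constraint failed at the minimizer, stationarity would produce an approximate multiplier of norm
exactly `α`, exceeding the bound. Two critical steps coincide because adding their two support
inequalities gives `μ ‖d₁ - d₂‖² ≤ ρ ‖D (d₁ - d₂)‖²` (`critical_step_unique`). -/

namespace ProxLin

/-! ### Nearest points and uniform proximal radius -/

section Projection

variable {X : Type*} [NormedAddCommGroup X]

/-- `p` is a nearest point to `y` in `S`. -/
def IsNearest (S : Set X) (y p : X) : Prop := p ∈ S ∧ ∀ q ∈ S, dist y p ≤ dist y q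

theorem mem_of_mem_closure_of_isNearest {S : Set X} {y p : X} (hy : y ∈ closure S)
    (hp : IsNearest S y p) : y ∈ S := by
  have h0 : dist y p ≤ 0 := by
    refine le_of_forall_pos_le_add fun ε hε => ?_
    obtain ⟨q, hq, hd⟩ := Metric.mem_closure_iff.1 hy ε hε
    linarith [hp.2 q hq]
  have : y = p := dist_le_zero.1 h0
  exact this ▸ hp.1

theorem IsNearest.infDist_eq {S : Set X} {y p : X} (hp : IsNearest S y p) :
    Metric.infDist y S = dist y p :=
  le_antisymm (Metric.infDist_le_dist_of_mem hp.1)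
    ((Metric.le_infDist ⟨p, hp.1⟩).2 fun {q} hq => hp.2 q hq)

/-- Nearest points depend continuously on the point, where they are unique. -/
theorem tendsto_of_isNearest [ProperSpace X] {S : Set X} {s : X} {R : ℝ} (hs : s ∈ S)
    (hU : ∀ y ∈ Metric.ball s R, ∃! p, IsNearest S y p) {y q : X}
    (hy : y ∈ Metric.ball s (R / 3)) (hq : IsNearest S y q)
    {ι : Type*} {l : Filter ι} {u p : ι → X} (hu : Tendsto u l (𝓝 y))
    (hp : ∀ᶠ i in l, IsNearest S (u i) (p i)) : Tendsto p l (𝓝 q) := by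
  have hR : 0 < R := by
    have := Metric.mem_ball.1 hy
    linarith [dist_nonneg (x := y) (y := s)]
  refine (isCompact_closedBall s (2 * R / 3)).tendsto_nhds_of_unique_mapClusterPt ?_ ?_
  · filter_upwards [hp, hu.eventually (Metric.isOpen_ball.mem_nhds hy)] with i hi hi'
    have h1 := hi.2 s hs
    have h2 := Metric.mem_ball.1 hi'
    have h3 := dist_triangle (p i) (u i) s
    rw [dist_comm (p i) (u i)] at h3
    exact Metric.mem_closedBall.2 (by linarith)
  · intro x hx hcl
    obtain ⟨U, hUl, hUx⟩ := mapClusterPt_iff_ultrafilter.1 hcl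
    have hpU : ∀ᶠ i in (U : Filter ι), IsNearest S (u i) (p i) := hUl hp
    -- `S` is not assumed closed: a cluster point inside the ball has a nearest point by hypothesis,
    -- necessarily at distance zero.
    have hxS : x ∈ S := by
      have hxc : x ∈ closure S := mem_closure_of_tendsto hUx (hpU.mono fun i hi => hi.1)
      have hxb : x ∈ Metric.ball s R := by
        have := Metric.mem_closedBall.1 hx
        exact Metric.mem_ball.2 (by linarith)
      obtain ⟨z, hz, -⟩ := hU x hxb
      exact mem_of_mem_closure_of_isNearest hxc hz
    have hxn : IsNearest S y x := ⟨hxS, fun q' hq' =>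
      le_of_tendsto_of_tendsto ((hu.mono_left hUl).dist hUx)
        ((hu.mono_left hUl).dist tendsto_const_nhds) (hpU.mono fun i hi => hi.2 q' hq')⟩
    refine (hU y ?_).unique hxn hq
    exact Metric.ball_subset_ball (by linarith) hy

variable [InnerProductSpace ℝ X]

/-- Squaring the distances cancels `‖t • w‖ ^ 2`. In this form, changing the length of a normal is a
matter of arithmetic. -/
theorem isNearest_add_smul_iff {S : Set X} {p w : X} {t : ℝ} (hp : p ∈ S) :
    IsNearest S (p + t • w) p ↔ ∀ q ∈ S, 2 * t * inner ℝ w (q - p) ≤ ‖q - p‖ ^ 2 := by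
  have key : ∀ q, dist (p + t • w) p ≤ dist (p + t • w) q ↔
      2 * t * inner ℝ w (q - p) ≤ ‖q - p‖ ^ 2 := by
    intro q
    rw [dist_eq_norm, dist_eq_norm, ← sq_le_sq₀ (norm_nonneg _) (norm_nonneg _)]
    have e1 : p + t • w - p = t • w := by abel
    have e2 : p + t • w - q = t • w - (q - p) := by abel
    rw [e1, e2, norm_sub_sq_real, real_inner_smul_left]
    constructor <;> intro h <;> linarith
  exact ⟨fun h q hq => (key q).1 (h.2 q hq), fun h => ⟨hp, fun q hq => (key q).2 (h q hq)⟩⟩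

/-- Off the set, its distance function grows at a rate close to one in some direction. -/
theorem exists_infDist_ascent [ProperSpace X] {S : Set X} {s : X} {R : ℝ} (hs : s ∈ S)
    (hU : ∀ y ∈ Metric.ball s R, ∃! p, IsNearest S y p) {y : X}
    (hy : y ∈ Metric.ball s (R / 3)) (hpos : 0 < Metric.infDist y S) {ε : ℝ} (hε : 0 < ε)
    {η : ℝ} (hη : 0 < η) :
    ∃ y', dist y' y < η ∧
      Metric.infDist y S + (1 - ε) * dist y' y < Metric.infDist y' S := by
  have hR : 0 < R := by
    have := Metric.mem_ball.1 hy
    linarith [dist_nonneg (x := y) (y := s)]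
  obtain ⟨q, hq, -⟩ := hU y (Metric.ball_subset_ball (by linarith) hy)
  have hD : Metric.infDist y S = ‖y - q‖ := by rw [hq.infDist_eq, dist_eq_norm]
  set D := ‖y - q‖ with hDdef
  rw [hD] at hpos ⊢
  -- Ascent along the ray from `q` through `y`: if `q_t` is nearest to `y + t • w`, the squared
  -- distance is `‖y - q_t‖ ^ 2 + 2 t ⟪w, y - q_t⟫ + t ^ 2` with `‖y - q_t‖ ≥ D`, and the inner
  -- product tends to `D` because `q_t → q`.
  set w : X := D⁻¹ • (y - q) with hw
  have hw1 : ‖w‖ = 1 := by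
    rw [hw, norm_smul, norm_inv, Real.norm_of_nonneg hpos.le, ← hDdef,
      inv_mul_cancel₀ hpos.ne']
  choose! P hP hP' using hU
  have hut : Tendsto (fun t : ℝ => y + t • w) (𝓝[>] 0) (𝓝 y) := by
    have : Tendsto (fun t : ℝ => y + t • w) (𝓝 0) (𝓝 (y + (0 : ℝ) • w)) :=
      (continuous_const.add (continuous_id.smul continuous_const)).tendsto 0
    rw [zero_smul, add_zero] at this
    exact this.mono_left nhdsWithin_le_nhds
  have hin : ∀ᶠ t : ℝ in 𝓝[>] 0, IsNearest S (y + t • w) (P (y + t • w)) := by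
    filter_upwards [hut.eventually (Metric.isOpen_ball.mem_nhds hy)] with t ht
    exact hP _ (Metric.ball_subset_ball (by linarith) ht)
  have hPt := tendsto_of_isNearest hs (fun y hy => ⟨P y, hP y hy, hP' y hy⟩) hy hq hut hin
  have hlim : Tendsto (fun t : ℝ => 2 * inner ℝ w (y - P (y + t • w))) (𝓝[>] 0)
      (𝓝 (2 * D)) := by
    have : inner ℝ w (y - q) = D := by
      rw [hw, real_inner_smul_left, real_inner_self_eq_norm_sq, ← hDdef]
      field_simp
    rw [← this]
    exact ((tendsto_const_nhds.inner (tendsto_const_nhds.sub hPt))).const_mul 2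
  have hlim2 : Tendsto (fun t : ℝ => 2 * (1 - ε) * D + (1 - ε) ^ 2 * t) (𝓝[>] 0)
      (𝓝 (2 * (1 - ε) * D)) := by
    have : Tendsto (fun t : ℝ => 2 * (1 - ε) * D + (1 - ε) ^ 2 * t) (𝓝 0)
      (𝓝 (2 * (1 - ε) * D + (1 - ε) ^ 2 * 0)) := by
      exact (continuous_const.add (continuous_const.mul continuous_id)).tendsto 0
    rw [mul_zero, add_zero] at this
    exact this.mono_left nhdsWithin_le_nhds
  have hlt := hlim2.eventually_lt hlim (by nlinarith)
  have hsmall : ∀ᶠ t : ℝ in 𝓝[>] 0, t < η :=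
    (gt_mem_nhds hη).filter_mono nhdsWithin_le_nhds
  obtain ⟨t, h1, h2, h3, h4⟩ := (hlt.and (hin.and (hsmall.and self_mem_nhdsWithin))).exists
  have h4 : 0 < t := h4
  have hdt : dist (y + t • w) y = t := by
    rw [dist_eq_norm, add_sub_cancel_left, norm_smul, hw1, Real.norm_of_nonneg h4.le, mul_one]
  refine ⟨y + t • w, by rw [hdt]; exact h3, ?_⟩
  rw [hdt, h2.infDist_eq, dist_eq_norm]
  refine lt_of_pow_lt_pow_left₀ 2 (norm_nonneg _) ?_
  have e : y + t • w - P (y + t • w) = (y - P (y + t • w)) + t • w := by abel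
  have hge : D ≤ ‖y - P (y + t • w)‖ := by
    have := hq.2 _ h2.1
    rwa [dist_eq_norm, dist_eq_norm] at this
  have hge2 : D ^ 2 ≤ ‖y - P (y + t • w)‖ ^ 2 := pow_le_pow_left₀ hpos.le hge 2
  rw [e, norm_add_sq_real, real_inner_smul_right, norm_smul, hw1, Real.norm_of_nonneg h4.le,
    real_inner_comm]
  nlinarith

/-- Nearest points stay nearest when one moves further away from them along the normal. -/
theorem IsNearest.extend [ProperSpace X] {S : Set X} {s : X} {R : ℝ} (hs : s ∈ S)
    (hU : ∀ y ∈ Metric.ball s R, ∃! p, IsNearest S y p) {y₀ p : X} (hp : IsNearest S y₀ p)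
    (hpos : 0 < dist y₀ p) {r : ℝ} (hr : 0 < r)
    (hsub : Metric.closedBall y₀ r ⊆ Metric.ball s (R / 3)) :
    IsNearest S (y₀ + (r / dist y₀ p) • (y₀ - p)) p := by
  have hcont : Continuous fun y => Metric.infDist y S := Metric.continuous_infDist_pt S
  have hK : IsCompact (Metric.closedBall y₀ r) := isCompact_closedBall _ _
  have hne : (Metric.closedBall y₀ r).Nonempty := ⟨y₀, Metric.mem_closedBall_self hr.le⟩
  have step : ∀ ε : ℝ, 0 < ε → ε < 1 → ∃ y ∈ Metric.closedBall y₀ r,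
      dist y₀ p + (1 - ε) * r ≤ Metric.infDist y S := by
    intro ε hε hε1
    -- A maximizer off the bounding sphere could be improved by `exists_infDist_ascent`, so the
    -- distance to `S` gains at least `(1 - ε) * r` at some point of the sphere.
    obtain ⟨y, hy, hmax⟩ := hK.exists_isMaxOn hne
      (f := fun y => Metric.infDist y S - (1 - ε) * dist y y₀)
      ((hcont.sub (continuous_const.mul (continuous_id.dist continuous_const))).continuousOn)
    have h0 := hmax (Metric.mem_closedBall_self hr.le)
    simp only [Set.mem_ofPred_eq, dist_self, mul_zero, sub_zero, hp.infDist_eq] at h0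
    refine ⟨y, hy, ?_⟩
    rcases (Metric.mem_closedBall.1 hy).lt_or_eq with hlt | heq
    · exfalso
      have hdy : 0 < Metric.infDist y S := by
        nlinarith [dist_nonneg (x := y) (y := y₀)]
      obtain ⟨y', h1, h2⟩ := exists_infDist_ascent hs hU (hsub hy) hdy hε
        (sub_pos.2 hlt)
      have h3 := dist_triangle y' y y₀
      have h4 := hmax (Metric.mem_closedBall.2 (by linarith : dist y' y₀ ≤ r))
      simp only [Set.mem_ofPred_eq] at h4
      nlinarith
    · rw [heq] at h0; linarith
  obtain ⟨y, hy, hmax⟩ := hK.exists_isMaxOn hne hcont.continuousOn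
  have hge : dist y₀ p + r ≤ Metric.infDist y S := by
    refine le_of_forall_pos_le_add fun δ hδ => ?_
    have hm : 0 < min (δ / r) (1 / 2) := lt_min (by positivity) (by norm_num)
    obtain ⟨z, hz, hz'⟩ := step (min (δ / r) (1 / 2)) hm
      (lt_of_le_of_lt (min_le_right _ _) (by norm_num))
    have h1 : Metric.infDist z S ≤ Metric.infDist y S := hmax hz
    have h2 : min (δ / r) (1 / 2) * r ≤ δ := by
      calc _ ≤ δ / r * r := mul_le_mul_of_nonneg_right (min_le_left _ _) hr.le
        _ = δ := by field_simp
    nlinarith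
  have hle : Metric.infDist y S ≤ dist y p := Metric.infDist_le_dist_of_mem hp.1
  have htri := dist_triangle y y₀ p
  have hyr : dist y y₀ = r := le_antisymm (Metric.mem_closedBall.1 hy) (by linarith)
  -- Equality in the triangle inequality puts `y` on the ray from `p` through `y₀`.
  have hsum : dist y p = dist y₀ p + r := by linarith
  have hinner : inner ℝ (y - y₀) (y₀ - p) = ‖y - y₀‖ * ‖y₀ - p‖ := by
    have e : y - p = (y - y₀) + (y₀ - p) := by abel
    have h := norm_add_sq_real (y - y₀) (y₀ - p)
    rw [← e, ← dist_eq_norm, ← dist_eq_norm, ← dist_eq_norm, hsum, hyr] at h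
    rw [← dist_eq_norm, ← dist_eq_norm, hyr]
    nlinarith
  have hvec := inner_eq_norm_mul_iff_real.1 hinner
  rw [← dist_eq_norm, ← dist_eq_norm, hyr] at hvec
  have hy' : y = y₀ + (r / dist y₀ p) • (y₀ - p) := by
    rw [div_eq_inv_mul, mul_smul, ← hvec, smul_smul, inv_mul_cancel₀ hpos.ne', one_smul]
    abel
  rw [← hy']
  exact ⟨hp.1, fun q hq => by linarith [Metric.infDist_le_dist_of_mem (x := y) hq]⟩

/-- Proximal normals at points near `s` have uniform radius. -/
theorem IsNearest.inner_le [ProperSpace X] {S : Set X} {s : X} {r : ℝ} (hs : s ∈ S)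
    (hU : ∀ y ∈ Metric.ball s (12 * r), ∃! p, IsNearest S y p) {p w : X}
    (hps : p ∈ Metric.ball s r) {t : ℝ} (ht : 0 < t) (hp : IsNearest S (p + t • w) p) :
    ∀ q ∈ S, 2 * r * inner ℝ w (q - p) ≤ ‖w‖ * ‖q - p‖ ^ 2 := by
  intro q hq
  have hr : 0 < r := lt_of_le_of_lt dist_nonneg (Metric.mem_ball.1 hps)
  rcases eq_or_ne w 0 with rfl | hw
  · simp
  have hwn : 0 < ‖w‖ := norm_pos_iff.2 hw
  rcases le_or_gt (inner ℝ w (q - p)) 0 with hneg | hpos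
  · nlinarith [mul_nonneg hwn.le (sq_nonneg ‖q - p‖), mul_nonneg hr.le (neg_nonneg.2 hneg)]
  obtain ⟨u, hu⟩ : ∃ u : X, u = ‖w‖⁻¹ • w := ⟨_, rfl⟩
  have hu1 : ‖u‖ = 1 := by
    rw [hu, norm_smul, norm_inv, norm_norm, inv_mul_cancel₀ hwn.ne']
  have hwu : w = ‖w‖ • u := by rw [hu, smul_smul, mul_inv_cancel₀ hwn.ne', one_smul]
  -- The cap at `r` keeps the ball of radius `r` about `p + t' • u` within `3 * r` of `s`, inside
  -- the radius `12 * r / 3` that `IsNearest.extend` needs.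
  set t' := min (t * ‖w‖) r with ht'
  have ht'0 : 0 < t' := lt_min (by positivity) hr
  have hn := (isNearest_add_smul_iff hp.1).1 hp
  have hn' : IsNearest S (p + t' • u) p := by
    refine (isNearest_add_smul_iff hp.1).2 fun q hq => ?_
    have h1 := hn q hq
    rw [hwu, real_inner_smul_left] at h1
    rcases le_or_gt (inner ℝ u (q - p)) 0 with h | h
    · nlinarith [sq_nonneg ‖q - p‖, mul_nonneg ht'0.le (neg_nonneg.2 h)]
    · have h2 := mul_le_mul_of_nonneg_right (min_le_left (t * ‖w‖) r) h.le
      rw [← ht'] at h2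
      linarith
  have hd : dist (p + t' • u) p = t' := by
    rw [dist_eq_norm, add_sub_cancel_left, norm_smul, hu1, Real.norm_of_nonneg ht'0.le, mul_one]
  have hsub : Metric.closedBall (p + t' • u) r ⊆ Metric.ball s (12 * r / 3) := by
    intro z hz
    have h1 := Metric.mem_closedBall.1 hz
    have h2 := Metric.mem_ball.1 hps
    have h3 := dist_triangle z (p + t' • u) s
    have h4 := dist_triangle (p + t' • u) p s
    have h5 : t' ≤ r := min_le_right _ _
    exact Metric.mem_ball.2 (by linarith)
  have hext := IsNearest.extend hs hU hn' (by rw [hd]; exact ht'0) hr hsub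
  rw [hd, add_sub_cancel_left, smul_smul, div_mul_cancel₀ _ ht'0.ne', add_assoc, ← add_smul,
    isNearest_add_smul_iff hp.1] at hext
  have h6 := hext q hq
  rw [hwu, real_inner_smul_left] at hpos
  rw [hwu, real_inner_smul_left, ← hwu]
  have h7 : 0 < inner ℝ u (q - p) := pos_of_mul_pos_right hpos hwn.le
  have h8 : 2 * r * inner ℝ u (q - p) ≤ ‖q - p‖ ^ 2 := by nlinarith [mul_pos ht'0 h7]
  calc _ = ‖w‖ * (2 * r * inner ℝ u (q - p)) := by ring
    _ ≤ _ := mul_le_mul_of_nonneg_left h8 hwn.le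

/-- A prox-regular set is locally closed, and its regular normals near the reference point satisfy
a uniform quadratic inequality. -/
theorem SetProxRegularAt.exists_normal_bound [ProperSpace X] {S : Set X} {s : X}
    (hS : SetProxRegularAt S s) :
    ∃ r > 0, (∀ y ∈ Metric.ball s r, y ∈ closure S → y ∈ S) ∧
      ∀ p ∈ S, p ∈ Metric.ball s r → ∀ v : X,
        (∀ ε > 0, ∀ᶠ q in 𝓝 p, q ∈ S → inner ℝ v (q - p) ≤ ε * ‖q - p‖) →
        ∀ q ∈ S, 2 * r * inner ℝ v (q - p) ≤ ‖v‖ * ‖q - p‖ ^ 2 := by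
  obtain ⟨hs, hev⟩ := hS
  obtain ⟨R, hR, hball⟩ := Metric.eventually_nhds_iff_ball.1 hev
  have hU : ∀ y ∈ Metric.ball s (12 * (R / 12)), ∃! p, IsNearest S y p := by
    intro y hy
    exact hball y (by rwa [mul_div_cancel₀ _ (by norm_num : (12 : ℝ) ≠ 0)] at hy)
  generalize hrdef : R / 12 = r at hU
  have hr : 0 < r := by rw [← hrdef]; positivity
  refine ⟨r, hr, fun y hy hyc => ?_, fun p hpS hps v hv q hq => ?_⟩
  · obtain ⟨z, hz, -⟩ := hU y (Metric.ball_subset_ball (by linarith) hy)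
    exact mem_of_mem_closure_of_isNearest hyc hz
  have hU' := hU
  choose! P hP hP' using hU
  have hut : Tendsto (fun t : ℝ => p + t • v) (𝓝[>] 0) (𝓝 p) := by
    have : Tendsto (fun t : ℝ => p + t • v) (𝓝 0) (𝓝 (p + (0 : ℝ) • v)) :=
      (continuous_const.add (continuous_id.smul continuous_const)).tendsto 0
    rw [zero_smul, add_zero] at this
    exact this.mono_left nhdsWithin_le_nhds
  have hin : ∀ᶠ t : ℝ in 𝓝[>] 0, IsNearest S (p + t • v) (P (p + t • v)) := by
    filter_upwards [hut.eventually (Metric.isOpen_ball.mem_nhds hps)] with t ht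
    exact hP _ (Metric.ball_subset_ball (by linarith) ht)
  have hpp : IsNearest S p p := ⟨hpS, fun q _ => by rw [dist_self]; exact dist_nonneg⟩
  have hPt : Tendsto (fun t : ℝ => P (p + t • v)) (𝓝[>] 0) (𝓝 p) :=
    tendsto_of_isNearest hs hU' (Metric.ball_subset_ball (by linarith) hps) hpp hut hin
  have hpos : ∀ᶠ t : ℝ in 𝓝[>] 0, 0 < t := self_mem_nhdsWithin
  -- Regular normals are limits of proximal ones. With `a = ‖P (p + t • v) - p‖`, nearestness gives
  -- `a ^ 2 ≤ 2 t ⟪v, P (p + t • v) - p⟫` and regularity bounds the inner product by `ε / 4 * a`, so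
  -- `a = o(t)`.
  have hw : Tendsto (fun t : ℝ => t⁻¹ • (p + t • v - P (p + t • v))) (𝓝[>] 0) (𝓝 v) := by
    rw [tendsto_iff_norm_sub_tendsto_zero, Metric.tendsto_nhds]
    intro ε hε
    filter_upwards [hPt.eventually (hv (ε / 4) (by positivity)), hin, hpos] with t h1 h2 h3
    have h4 := h1 h2.1
    have h5 := h2.2 p hpS
    rw [dist_eq_norm, dist_eq_norm, ← sq_le_sq₀ (norm_nonneg _) (norm_nonneg _)] at h5
    have e1 : p + t • v - p = t • v := by abel
    have e2 : p + t • v - P (p + t • v) = t • v - (P (p + t • v) - p) := by abel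
    rw [e1, e2, norm_sub_sq_real, real_inner_smul_left] at h5
    set a := ‖P (p + t • v) - p‖ with ha
    have h6 : a ≤ ε / 2 * t := by
      by_contra hcon
      push Not at hcon
      have : 0 < a := lt_trans (by positivity) hcon
      nlinarith
    have e3 : t⁻¹ • (p + t • v - P (p + t • v)) - v = -(t⁻¹ • (P (p + t • v) - p)) := by
      rw [e2, smul_sub, smul_smul, inv_mul_cancel₀ h3.ne', one_smul]; abel
    rw [e3, norm_neg, norm_smul, norm_inv, Real.norm_of_nonneg h3.le, ← ha, Real.dist_eq,
      sub_zero, abs_of_nonneg (by positivity)]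
    calc t⁻¹ * a ≤ t⁻¹ * (ε / 2 * t) := by gcongr
      _ = ε / 2 := by field_simp
      _ < ε := by linarith
  refine le_of_tendsto_of_tendsto ((hw.inner (tendsto_const_nhds.sub hPt)).const_mul (2 * r))
    (hw.norm.mul ((tendsto_const_nhds.sub hPt).norm.pow 2)) ?_
  filter_upwards [hin, hpos, hPt.eventually (Metric.isOpen_ball.mem_nhds hps)] with t h1 h2 h3
  refine IsNearest.inner_le hs hU' h3 h2 ?_ q hq
  rwa [smul_smul, mul_inv_cancel₀ h2.ne', one_smul, add_sub_cancel]

end Projection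

/-! ### Subgradients of real-valued functions -/

section RealSubdiff

variable {Y : Type*} [NormedAddCommGroup Y] [InnerProductSpace ℝ Y]

/-- Regular subgradients of a real-valued function. -/
def realRegSubdiff (φ : Y → ℝ) (z : Y) : Set Y :=
  {v | ∀ ε : ℝ, 0 < ε → ∀ᶠ z' in 𝓝 z, φ z + (inner ℝ v (z' - z) - ε * ‖z' - z‖) ≤ φ z'}

/-- Limiting subgradients of a real-valued function. -/
def realSubdiff (φ : Y → ℝ) (z : Y) : Set Y :=
  {v | ∀ ε : ℝ, 0 < ε → ∃ z' v', dist z' z < ε ∧ dist (φ z') (φ z) < ε ∧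
    v' ∈ realRegSubdiff φ z' ∧ dist v' v < ε}

theorem exists_seq_of_forall_pos {α : Type*} {P : ℝ → α → Prop}
    (hP : ∀ ε > 0, ∃ a, P ε a) : ∃ (u : ℕ → α) (e : ℕ → ℝ), (∀ j, P (e j) (u j)) ∧
      Tendsto e atTop (𝓝 0) := by
  choose u hu using fun j : ℕ => hP (1 / ((j : ℝ) + 1)) Nat.one_div_pos_of_nat
  exact ⟨u, _, hu, tendsto_one_div_add_atTop_nhds_zero_nat⟩

theorem tendsto_of_dist_lt {α : Type*} [PseudoMetricSpace α] {u : ℕ → α} {e : ℕ → ℝ} {x : α}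
    (hu : ∀ j, dist (u j) x < e j) (he : Tendsto e atTop (𝓝 0)) : Tendsto u atTop (𝓝 x) :=
  tendsto_iff_dist_tendsto_zero.2
    (squeeze_zero (fun _ => dist_nonneg) (fun j => (hu j).le) he)

theorem exists_seq_of_mem_realSubdiff {φ : Y → ℝ} {z v : Y} (hv : v ∈ realSubdiff φ z) :
    ∃ zs vs : ℕ → Y, Tendsto zs atTop (𝓝 z) ∧ Tendsto (fun j => φ (zs j)) atTop (𝓝 (φ z)) ∧
      (∀ j, vs j ∈ realRegSubdiff φ (zs j)) ∧ Tendsto vs atTop (𝓝 v) := by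
  obtain ⟨u, e, hu, he⟩ := exists_seq_of_forall_pos
    (P := fun ε (p : Y × Y) => dist p.1 z < ε ∧ dist (φ p.1) (φ z) < ε ∧
      p.2 ∈ realRegSubdiff φ p.1 ∧ dist p.2 v < ε)
    (fun ε hε => by obtain ⟨z', v', h⟩ := hv ε hε; exact ⟨(z', v'), h⟩)
  exact ⟨fun j => (u j).1, fun j => (u j).2, tendsto_of_dist_lt (fun j => (hu j).1) he,
    tendsto_of_dist_lt (fun j => (hu j).2.1) he, fun j => (hu j).2.2.1,
    tendsto_of_dist_lt (fun j => (hu j).2.2.2) he⟩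

theorem realRegSubdiff_subset (φ : Y → ℝ) (z : Y) : realRegSubdiff φ z ⊆ realSubdiff φ z :=
  fun v hv ε hε => ⟨z, v, by simpa using hε, by simpa using hε, hv, by simpa using hε⟩

/-- The graph of the subdifferential is closed under attentive convergence. -/
theorem mem_realSubdiff_of_tendsto {φ : Y → ℝ} {z v : Y} {ι : Type*} {l : Filter ι} [l.NeBot]
    {zs vs : ι → Y} (hz : Tendsto zs l (𝓝 z)) (hφ : Tendsto (fun j => φ (zs j)) l (𝓝 (φ z)))
    (hmem : ∀ᶠ j in l, vs j ∈ realSubdiff φ (zs j)) (hv : Tendsto vs l (𝓝 v)) :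
    v ∈ realSubdiff φ z := by
  intro ε hε
  have h2 : 0 < ε / 2 := half_pos hε
  obtain ⟨j, h1, h3, h4, h5⟩ := ((Metric.tendsto_nhds.1 hz _ h2).and
    ((Metric.tendsto_nhds.1 hφ _ h2).and (hmem.and (Metric.tendsto_nhds.1 hv _ h2)))).exists
  obtain ⟨z', v', a1, a2, a3, a4⟩ := h4 _ h2
  exact ⟨z', v', by linarith [dist_triangle z' (zs j) z],
    by linarith [dist_triangle (φ z') (φ (zs j)) (φ z)], a3,
    by linarith [dist_triangle v' (vs j) v]⟩

end RealSubdiff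

/-! ### Truncation preserves subgradients below the truncation level -/

section Transfer

variable {k : ℕ} {f : Euc k → EReal} {ψ : Euc k → ℝ} {β : ℝ} {z : Euc k}

theorem coe_eq_of_lt_of_eq_min {x : EReal} {y b : ℝ} (h : (y : EReal) = min x b) (hy : y < b) :
    x = y := by
  rcases min_choice x (b : EReal) with h' | h'
  · rw [h, h']
  · rw [h', EReal.coe_eq_coe_iff] at h
    exact absurd h hy.ne

theorem eq_of_lt_of_eq_min {x : EReal} {y b : ℝ} (h : (y : EReal) = min x b)
    (hx : x < (b : EReal)) : x = y := by
  rw [h, min_eq_left hx.le]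

theorem tendsto_affine_sub_norm (a ε : ℝ) (v z : Euc k) :
    Tendsto (fun z' => a + (inner ℝ v (z' - z) - ε * ‖z' - z‖)) (𝓝 z) (𝓝 a) := by
  have : Continuous fun z' => a + (inner ℝ v (z' - z) - ε * ‖z' - z‖) := by fun_prop
  simpa using this.tendsto z

/-- Where the truncation is active its value is `β > ψ z`, and near `z` the affine minorant stays
below `β` by continuity; elsewhere the two functions agree. -/
theorem regularSubdiff_eq_real (hev : ∀ᶠ z' in 𝓝 z, (ψ z' : EReal) = min (f z') β)
    (hz : ψ z < β) : regularSubdiff f z = realRegSubdiff ψ z := by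
  have hfz : f z = ψ z := coe_eq_of_lt_of_eq_min hev.self_of_nhds hz
  ext v
  constructor
  · rintro ⟨-, -, h⟩ ε hε
    filter_upwards [h ε hε, hev, (tendsto_affine_sub_norm (ψ z) ε v z).eventually
      (gt_mem_nhds hz)] with z' h1 h2 h3
    rw [hfz, ← EReal.coe_add] at h1
    rw [← EReal.coe_le_coe_iff, h2]
    exact le_min h1 (EReal.coe_le_coe_iff.2 h3.le)
  · intro h
    refine ⟨by rw [hfz]; exact EReal.coe_ne_top _, by rw [hfz]; exact EReal.coe_ne_bot _, ?_⟩
    intro ε hε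
    filter_upwards [h ε hε, hev] with z' h1 h2
    rw [hfz, ← EReal.coe_add]
    refine (EReal.coe_le_coe_iff.2 h1).trans ?_
    rw [h2]
    exact min_le_left _ _

/-- Attentive convergence for an extended-real-valued function and its truncation agree. -/
theorem tendsto_truncation_iff {ι : Type*} {l : Filter ι} {zs : ι → Euc k}
    (hev : ∀ᶠ z' in 𝓝 z, (ψ z' : EReal) = min (f z') β) (hz : ψ z < β)
    (hzs : Tendsto zs l (𝓝 z)) :
    Tendsto (fun j => f (zs j)) l (𝓝 (f z)) ↔ Tendsto (fun j => ψ (zs j)) l (𝓝 (ψ z)) := by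
  have hfz : f z = ψ z := coe_eq_of_lt_of_eq_min hev.self_of_nhds hz
  rw [hfz]
  constructor
  · intro h
    rw [← EReal.tendsto_coe]
    refine h.congr' ?_
    filter_upwards [h.eventually (gt_mem_nhds (EReal.coe_lt_coe_iff.2 hz)),
      hzs.eventually hev] with j h1 h2
    exact eq_of_lt_of_eq_min h2 h1
  · intro h
    refine (EReal.tendsto_coe.2 h).congr' ?_
    filter_upwards [h.eventually (gt_mem_nhds hz), hzs.eventually hev] with j h1 h2
    exact (coe_eq_of_lt_of_eq_min h2 h1).symm

/-- Attentive convergence to a value below `β` eventually keeps the values below `β`, where the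
regular subgradients agree. A shift of the index turns "eventually" into the "for all" required by
`subdiff`. -/
theorem subdiff_eq_real (hev : ∀ᶠ z' in 𝓝 z, (ψ z' : EReal) = min (f z') β)
    (hz : ψ z < β) : subdiff f z = realSubdiff ψ z := by
  have hfz : f z = ψ z := coe_eq_of_lt_of_eq_min hev.self_of_nhds hz
  have hev' := eventually_eventually_nhds.2 hev
  ext v
  constructor
  · rintro ⟨-, -, zs, vs, h1, h2, h3, h4⟩
    have h2' := (tendsto_truncation_iff hev hz h1).1 h2
    refine mem_realSubdiff_of_tendsto h1 h2' ?_ h4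
    filter_upwards [h1.eventually hev', h2'.eventually (gt_mem_nhds hz)] with j a1 a2
    exact realRegSubdiff_subset _ _ (regularSubdiff_eq_real a1 a2 ▸ h3 j)
  · intro h
    obtain ⟨zs, vs, h1, h2, h3, h4⟩ := exists_seq_of_mem_realSubdiff h
    refine ⟨by rw [hfz]; exact EReal.coe_ne_top _, by rw [hfz]; exact EReal.coe_ne_bot _, ?_⟩
    obtain ⟨N, hN⟩ := eventually_atTop.1
      ((h1.eventually hev').and (h2.eventually (gt_mem_nhds hz)))
    have hsh : Tendsto (fun j : ℕ => j + N) atTop atTop := tendsto_add_atTop_nat N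
    refine ⟨fun j => zs (j + N), fun j => vs (j + N), h1.comp hsh,
      ((tendsto_truncation_iff hev hz h1).2 h2).comp hsh, fun j => ?_, h4.comp hsh⟩
    obtain ⟨a1, a2⟩ := hN (j + N) (Nat.le_add_left _ _)
    rw [regularSubdiff_eq_real a1 a2]
    exact h3 _

end Transfer

/-- A real-valued lower semicontinuous function, truncated above at level `β`, whose regular
subgradients near `cbar` satisfy a uniform quadratic inequality in the epigraph. -/
structure IsProxTruncation {Y : Type*} [NormedAddCommGroup Y] [InnerProductSpace ℝ Y]
    (φ : Y → ℝ) (cbar : Y) (β K δ : ℝ) : Prop where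
  lsc : LowerSemicontinuous φ
  bdd : ∃ B, ∀ z, B ≤ φ z
  le : ∀ z, φ z ≤ β
  lt : φ cbar < β
  pos : 0 < δ
  nonneg : 0 ≤ K
  ineq : ∀ z ∈ Metric.ball cbar δ, ∀ z' ∈ Metric.ball cbar δ, φ z < β → φ z' < β →
    ∀ v ∈ realRegSubdiff φ z, inner ℝ v (z' - z) - (φ z' - φ z) ≤
      K * (1 + ‖v‖) * (‖z' - z‖ ^ 2 + (φ z' - φ z) ^ 2)

/-! ### From the epigraph to the truncated function -/

section Epigraph

variable {k : ℕ} {h : Euc k → EReal}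

theorem mem_epigraph {z : Euc k} {t : ℝ} :
    WithLp.toLp 2 (z, t) ∈ epigraph h ↔ h z ≤ (t : EReal) := Iff.rfl

theorem norm_toLp_sq (z : Euc k) (t : ℝ) : ‖WithLp.toLp 2 (z, t)‖ ^ 2 = ‖z‖ ^ 2 + t ^ 2 := by
  rw [WithLp.prod_norm_sq_eq_of_L2]; simp

theorem dist_toLp_le (z z' : Euc k) (t t' : ℝ) :
    dist (WithLp.toLp 2 (z, t)) (WithLp.toLp 2 (z', t')) ≤ dist z z' + |t - t'| := by
  rw [dist_eq_norm, dist_eq_norm, ← WithLp.toLp_sub, Prod.mk_sub_mk,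
    ← sq_le_sq₀ (norm_nonneg _) (by positivity), norm_toLp_sq, ← sq_abs (t - t')]
  nlinarith [mul_nonneg (norm_nonneg (z - z')) (abs_nonneg (t - t'))]

/-- Regular subgradients give regular normals to the epigraph. -/
theorem normal_of_mem_regularSubdiff {z v : Euc k} {t : ℝ} (hz : h z = t)
    (hv : v ∈ regularSubdiff h z) :
    ∀ ε > 0, ∀ᶠ q in 𝓝 (WithLp.toLp 2 (z, t)), q ∈ epigraph h →
      inner ℝ (WithLp.toLp 2 (v, (-1 : ℝ))) (q - WithLp.toLp 2 (z, t)) ≤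
        ε * ‖q - WithLp.toLp 2 (z, t)‖ := by
  intro ε hε
  have hfst : Tendsto (fun q : WithLp 2 (Euc k × ℝ) => q.fst) (𝓝 (WithLp.toLp 2 (z, t)))
      (𝓝 z) := by
    have : Continuous fun q : WithLp 2 (Euc k × ℝ) => q.fst := by fun_prop
    exact this.tendsto (WithLp.toLp 2 (z, t))
  filter_upwards [hfst.eventually (hv.2.2 ε hε)] with q hq hqS
  have h1 := hq.trans hqS
  rw [hz, ← EReal.coe_add, EReal.coe_le_coe_iff] at h1
  have h2 : ‖q.fst - z‖ ≤ ‖q - WithLp.toLp 2 (z, t)‖ := by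
    rw [← sq_le_sq₀ (norm_nonneg _) (norm_nonneg _), WithLp.prod_norm_sq_eq_of_L2]
    have : (q - WithLp.toLp 2 (z, t)).fst = q.fst - z := rfl
    rw [this]
    nlinarith [sq_nonneg ‖(q - WithLp.toLp 2 (z, t)).snd‖]
  have h3 : inner ℝ (WithLp.toLp 2 (v, (-1 : ℝ))) (q - WithLp.toLp 2 (z, t)) =
      inner ℝ v (q.fst - z) - (q.snd - t) := by
    rw [WithLp.prod_inner_apply]
    simp
    ring
  rw [h3]
  nlinarith [mul_le_mul_of_nonneg_left h2 hε.le]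

/-- Near a point of prox-regularity, truncation reduces to the real-valued case. -/
theorem ProxRegularAt.exists_truncation {cbar : Euc k} (hprox : ProxRegularAt h cbar) :
    ∃ (φ : Euc k → ℝ) (β K δ : ℝ), IsProxTruncation φ cbar β K δ ∧
      ∀ z ∈ Metric.ball cbar δ, (φ z : EReal) = min (h z) β := by
  classical
  obtain ⟨htop, hbot, hS⟩ := hprox
  obtain ⟨a, ha⟩ : ∃ a : ℝ, a = (h cbar).toReal := ⟨_, rfl⟩
  have hca : h cbar = a := by rw [ha, EReal.coe_toReal htop hbot]
  rw [← ha] at hS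
  obtain ⟨r, hr, hcl, hnor⟩ := hS.exists_normal_bound
  have hin : ∀ z t, dist z cbar ≤ r / 4 → |t - a| ≤ r / 4 →
      WithLp.toLp 2 (z, t) ∈ Metric.ball (WithLp.toLp 2 (cbar, a)) r := fun z t h1 h2 =>
    Metric.mem_ball.2 (lt_of_le_of_lt (dist_toLp_le _ _ _ _) (by linarith))
  have hcont : ∀ y : ℝ, Continuous fun z : Euc k => WithLp.toLp 2 (z, y) := by
    intro y; fun_prop
  -- Otherwise `(cbar, a - r / 4)` would be a limit of epigraph points, hence in the epigraph by
  -- local closedness, although `h cbar = a`.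
  have hlow : ∀ᶠ z in 𝓝 cbar, ((a - r / 4 : ℝ) : EReal) ≤ h z := by
    by_contra hcon
    rw [not_eventually] at hcon
    have hmem : WithLp.toLp 2 (cbar, a - r / 4) ∈ closure (epigraph h) :=
      mem_closure_of_frequently_of_tendsto
        (hcon.mono fun z hz => mem_epigraph.2 (not_le.1 hz).le) ((hcont _).tendsto cbar)
    have := hcl _ (hin cbar (a - r / 4) (by rw [dist_self]; positivity)
      (by rw [sub_sub_cancel_left, abs_neg, abs_of_pos (by positivity)])) hmem
    rw [mem_epigraph, hca, EReal.coe_le_coe_iff] at this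
    linarith
  obtain ⟨ρ, hρ, hlow⟩ := Metric.eventually_nhds_iff_ball.1 hlow
  obtain ⟨δ, hδ⟩ : ∃ δ, δ = min (ρ / 2) (r / 4) := ⟨_, rfl⟩
  have hδ0 : 0 < δ := by rw [hδ]; exact lt_min (by positivity) (by positivity)
  have hδr : δ ≤ r / 4 := hδ ▸ min_le_right _ _
  have hδρ : δ ≤ ρ / 2 := hδ ▸ min_le_left _ _
  have hlow' : ∀ z, dist z cbar ≤ δ → ((a - r / 4 : ℝ) : EReal) ≤ h z := fun z hz =>
    hlow z (Metric.mem_ball.2 (by linarith))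
  -- Truncating on a closed ball and using the top value outside makes `φ` globally lower
  -- semicontinuous: sublevel sets below `a + δ` lie in the ball, at heights where the epigraph is
  -- locally closed.
  obtain ⟨φ, hφ⟩ : ∃ φ : Euc k → ℝ, φ = fun z =>
    if dist z cbar ≤ δ then (min (h z) ((a + δ : ℝ) : EReal)).toReal else a + δ := ⟨_, rfl⟩
  have hin1 : ∀ z, dist z cbar ≤ δ → (φ z : EReal) = min (h z) ((a + δ : ℝ) : EReal) := by
    intro z hz
    simp only [hφ, if_pos hz]
    refine EReal.coe_toReal ?_ ?_
    · exact ((min_le_right _ _).trans_lt (EReal.coe_lt_top _)).ne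
    · exact ((EReal.bot_lt_coe _).trans_le (le_min (hlow' z hz)
        (EReal.coe_le_coe_iff.2 (by linarith : a - r / 4 ≤ a + δ)))).ne'
  have hout : ∀ z, ¬ dist z cbar ≤ δ → φ z = a + δ := by
    intro z hz
    simp only [hφ, if_neg hz]
  have hge : ∀ z, a - r / 4 ≤ φ z := by
    intro z
    by_cases hz : dist z cbar ≤ δ
    · rw [← EReal.coe_le_coe_iff, hin1 z hz]
      exact le_min (hlow' z hz) (EReal.coe_le_coe_iff.2 (by linarith))
    · rw [hout z hz]; linarith
  have hle : ∀ z, φ z ≤ a + δ := by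
    intro z
    by_cases hz : dist z cbar ≤ δ
    · rw [← EReal.coe_le_coe_iff, hin1 z hz]
      exact min_le_right _ _
    · rw [hout z hz]
  have hφc : φ cbar = a := by
    rw [← EReal.coe_eq_coe_iff, hin1 cbar (by rw [dist_self]; exact hδ0.le), hca]
    exact min_eq_left (EReal.coe_le_coe_iff.2 (by linarith))
  refine ⟨φ, a + δ, 1 / (2 * r), δ, ⟨?_, ⟨_, hge⟩, hle, by rw [hφc]; linarith, hδ0,
    by positivity, ?_⟩, fun z hz => hin1 z (Metric.mem_ball.1 hz).le⟩
  · rw [lowerSemicontinuous_iff_isClosed_preimage]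
    intro y
    rcases le_or_gt (a + δ) y with hy | hy
    · convert isClosed_univ
      exact Set.eq_univ_of_forall fun z => (hle z).trans hy
    rcases lt_or_ge y (a - r / 4) with hy' | hy'
    · convert isClosed_empty
      exact Set.eq_empty_of_forall_notMem fun z hz => by
        have : φ z ≤ y := hz
        linarith [hge z]
    have hset : ∀ z, φ z ≤ y → dist z cbar ≤ δ ∧ h z ≤ (y : EReal) := by
      intro z hz
      have hzb : dist z cbar ≤ δ := by
        by_contra hcon
        rw [hout z hcon] at hz
        linarith
      refine ⟨hzb, ?_⟩
      rw [coe_eq_of_lt_of_eq_min (hin1 z hzb) (by linarith)]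
      exact EReal.coe_le_coe_iff.2 hz
    refine isClosed_of_closure_subset fun z hz => ?_
    have h1 : dist z cbar ≤ δ := Metric.mem_closedBall.1
      (closure_minimal (fun w hw => Metric.mem_closedBall.2 (hset w hw).1)
        Metric.isClosed_closedBall hz)
    have h2 : WithLp.toLp 2 (z, y) ∈ closure (epigraph h) :=
      map_mem_closure (f := fun z : Euc k => WithLp.toLp 2 (z, y)) (hcont y) hz fun w hw => mem_epigraph.2 (hset w hw).2
    have h3 := mem_epigraph.1 (hcl _ (hin z y (h1.trans hδr)
      (abs_le.2 ⟨by linarith, by linarith⟩)) h2)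
    show φ z ≤ y
    rw [← EReal.coe_le_coe_iff, hin1 z h1]
    exact (min_le_left _ _).trans h3
  · intro z hz z' hz' hzb hzb' v hv
    have e1 := coe_eq_of_lt_of_eq_min (hin1 z (Metric.mem_ball.1 hz).le) hzb
    have e2 := coe_eq_of_lt_of_eq_min (hin1 z' (Metric.mem_ball.1 hz').le) hzb'
    have hev : ∀ᶠ w in 𝓝 z, (φ w : EReal) = min (h w) ((a + δ : ℝ) : EReal) := by
      filter_upwards [Metric.isOpen_ball.mem_nhds hz] with w hw
      exact hin1 w (Metric.mem_ball.1 hw).le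
    rw [← regularSubdiff_eq_real hev hzb] at hv
    have h1 := hnor (WithLp.toLp 2 (z, φ z)) (mem_epigraph.2 e1.le)
      (hin z _ ((Metric.mem_ball.1 hz).le.trans hδr)
        (abs_le.2 ⟨by linarith [hge z], by linarith [hle z]⟩)) _
      (normal_of_mem_regularSubdiff e1 hv) (WithLp.toLp 2 (z', φ z')) (mem_epigraph.2 e2.le)
    rw [← WithLp.toLp_sub, Prod.mk_sub_mk, norm_toLp_sq, WithLp.prod_inner_apply] at h1
    have h2 : ‖WithLp.toLp 2 (v, (-1 : ℝ))‖ ≤ 1 + ‖v‖ := by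
      rw [← sq_le_sq₀ (norm_nonneg _) (by positivity), norm_toLp_sq]
      nlinarith [norm_nonneg v]
    have h3 := h1.trans (mul_le_mul_of_nonneg_right h2 (by positivity))
    simp only [RCLike.inner_apply, conj_trivial] at h3
    have h4 : 1 / (2 * r) * (1 + ‖v‖) * (‖z' - z‖ ^ 2 + (φ z' - φ z) ^ 2) =
        ((1 + ‖v‖) * (‖z' - z‖ ^ 2 + (φ z' - φ z) ^ 2)) / (2 * r) := by ring
    rw [h4, le_div_iff₀ (by positivity)]
    linarith

/-- Regular subgradients of convex functions are global subgradients. -/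
theorem le_of_mem_regularSubdiff_of_convex (hconv : Convex ℝ (epigraph h)) {z v z' : Euc k}
    (hv : v ∈ regularSubdiff h z) {t t' : ℝ} (hz : h z = t) (hz' : h z' ≤ (t' : EReal)) :
    t + inner ℝ v (z' - z) ≤ t' := by
  refine le_of_forall_pos_le_add fun η hη => ?_
  obtain ⟨ε, hε, hεη⟩ : ∃ ε > 0, ε * ‖z' - z‖ ≤ η := by
    refine ⟨η / (‖z' - z‖ + 1), by positivity, ?_⟩
    rw [div_mul_eq_mul_div, div_le_iff₀ (by positivity)]
    nlinarith [norm_nonneg (z' - z)]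
  have hlim : Tendsto (fun s : ℝ => z + s • (z' - z)) (𝓝[>] 0) (𝓝 z) := by
    have : Tendsto (fun s : ℝ => z + s • (z' - z)) (𝓝 0) (𝓝 (z + (0 : ℝ) • (z' - z))) :=
      (continuous_const.add (continuous_id.smul continuous_const)).tendsto 0
    rw [zero_smul, add_zero] at this
    exact this.mono_left nhdsWithin_le_nhds
  have h1 : ∀ᶠ s : ℝ in 𝓝[>] 0, s < 1 := (gt_mem_nhds one_pos).filter_mono nhdsWithin_le_nhds
  obtain ⟨s, hs, hs1, hs0⟩ :=
    ((hlim.eventually (hv.2.2 ε hε)).and (h1.and self_mem_nhdsWithin)).exists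
  have hs0 : 0 < s := hs0
  have hmem := hconv (mem_epigraph.2 hz.le) (mem_epigraph.2 hz') (sub_nonneg.2 hs1.le) hs0.le
    (sub_add_cancel _ _)
  rw [← WithLp.toLp_smul, ← WithLp.toLp_smul, ← WithLp.toLp_add, Prod.smul_mk, Prod.smul_mk,
    Prod.mk_add_mk, mem_epigraph] at hmem
  have e : (1 - s) • z + s • z' = z + s • (z' - z) := by
    rw [sub_smul, one_smul, smul_sub]; abel
  rw [e] at hmem
  have h2 := hs.trans hmem
  rw [hz, ← EReal.coe_add, EReal.coe_le_coe_iff, add_sub_cancel_left, real_inner_smul_right,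
    norm_smul, Real.norm_of_nonneg hs0.le, smul_eq_mul, smul_eq_mul] at h2
  have h3 : s * (t + inner ℝ v (z' - z)) ≤ s * (t' + ε * ‖z' - z‖) := by linarith
  linarith [le_of_mul_le_mul_left h3 hs0]

end Epigraph

/-! ### Penalization and the fuzzy chain rule -/

section Calculus

variable {X Y : Type*} [NormedAddCommGroup X] [InnerProductSpace ℝ X]
  [NormedAddCommGroup Y] [InnerProductSpace ℝ Y]

/-- At a local minimizer of `φ` plus a quadratic, the linear part of the quadratic becomes a
subgradient and the remainder `κ / 2 * ‖z' - z‖ ^ 2` is `o(‖z' - z‖)`. Both penalty arguments obtain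
their subgradients this way. -/
theorem neg_smul_mem_realRegSubdiff {φ : Y → ℝ} {z y : Y} {κ : ℝ}
    (hmin : ∀ᶠ z' in 𝓝 z, φ z + κ / 2 * ‖z - y‖ ^ 2 ≤ φ z' + κ / 2 * ‖z' - y‖ ^ 2) :
    -(κ • (z - y)) ∈ realRegSubdiff φ z := by
  intro ε hε
  have hlim : Tendsto (fun z' => κ / 2 * ‖z' - z‖) (𝓝 z) (𝓝 0) := by
    have : Continuous fun z' => κ / 2 * ‖z' - z‖ := by fun_prop
    simpa using this.tendsto z
  filter_upwards [hmin, hlim.eventually (gt_mem_nhds hε)] with z' h1 h2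
  have e : z' - y = (z' - z) + (z - y) := by abel
  rw [e, norm_add_sq_real, real_inner_comm] at h1
  rw [inner_neg_left, real_inner_smul_left]
  nlinarith [mul_le_mul_of_nonneg_right h2.le (norm_nonneg (z' - z))]

/-- The one-sided bound is tested at both `x + w` and `x - w`. A positive `η` allows for the kink of
a norm term, and `η = 0` is Fermat's rule. -/
theorem norm_fderiv_le_of_eventually {f : X → ℝ} {f' : X →L[ℝ] ℝ} {x : X} {η : ℝ} (hη : 0 ≤ η)
    (hf : HasFDerivAt f f' x) (hmin : ∀ᶠ x' in 𝓝 x, f x - η * ‖x' - x‖ ≤ f x') : ‖f'‖ ≤ η := by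
  refine le_of_forall_pos_le_add fun ε hε => ?_
  refine ContinuousLinearMap.opNorm_le_of_nhds_zero (by positivity) ?_
  have hsub : Tendsto (fun w : X => x + w) (𝓝 0) (𝓝 x) := by
    have : Continuous fun w : X => x + w := by fun_prop
    simpa using this.tendsto 0
  have hsub' : Tendsto (fun w : X => x - w) (𝓝 0) (𝓝 x) := by
    have : Continuous fun w : X => x - w := by fun_prop
    simpa using this.tendsto 0
  have hboth := hmin.and (hf.isLittleO.def hε)
  filter_upwards [hsub.eventually hboth, hsub'.eventually hboth] with w h1 h2
  simp only [add_sub_cancel_left, sub_sub_cancel_left, norm_neg, map_neg] at h1 h2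
  have h3 := abs_le.1 (Real.norm_eq_abs _ ▸ h1.2)
  have h4 := abs_le.1 (Real.norm_eq_abs _ ▸ h2.2)
  rw [Real.norm_eq_abs, abs_le]
  constructor <;> nlinarith [h1.1, h2.1, h3.1, h3.2, h4.1, h4.2]

theorem le_of_lowerSemicontinuous_of_tendsto {Z : Type*} [TopologicalSpace Z] {φ : Z → ℝ}
    (hφ : LowerSemicontinuous φ) {ι : Type*} {l : Filter ι} [l.NeBot] {zs : ι → Z} {z : Z} {b : ι → ℝ} {b₀ : ℝ}
    (hz : Tendsto zs l (𝓝 z)) (hb : Tendsto b l (𝓝 b₀)) (hle : ∀ᶠ i in l, φ (zs i) ≤ b i) :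
    φ z ≤ b₀ := by
  refine le_of_forall_lt fun y hy => ?_
  obtain ⟨y', h1, h2⟩ := exists_between hy
  refine h1.trans_le (ge_of_tendsto hb ?_)
  filter_upwards [hz.eventually (hφ z y' h2), hle] with i a1 a2
  exact (a1.trans_le a2).le

theorem hasFDerivAt_penalty {g : X → Y} {g' : X →L[ℝ] Y} {x x₀ u : X} {z : Y} {κ : ℝ}
    [CompleteSpace X] [CompleteSpace Y]
    (hg : HasFDerivAt g g' x) :
    HasFDerivAt (fun x' => -inner ℝ u (x' - x₀) + κ / 2 * ‖z - g x'‖ ^ 2)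
      (innerSL ℝ (ContinuousLinearMap.adjoint g' (-(κ • (z - g x))) - u)) x := by
  have h1 : HasFDerivAt (fun x' : X => -inner ℝ u (x' - x₀)) (-innerSL ℝ u) x :=
    ((innerSL ℝ u).hasFDerivAt.comp x ((hasFDerivAt_id x).sub_const x₀)).neg
  have h2 := ((hg.const_sub z).norm_sq).const_mul (κ / 2)
  refine (h1.add h2).congr_fderiv ?_
  ext w
  simp only [add_apply, neg_apply,
    smul_apply, ContinuousLinearMap.comp_apply, innerSL_apply_apply,
    inner_sub_left, inner_neg_left, inner_neg_right, real_inner_smul_left, smul_eq_mul,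
    ContinuousLinearMap.adjoint_inner_left, nsmul_eq_mul, Nat.cast_ofNat]
  ring

/-- A fuzzy chain rule for regular subgradients of a composition. -/
theorem exists_approx_of_mem_realRegSubdiff_comp [ProperSpace X] [ProperSpace Y] {φ : Y → ℝ}
    (hlsc : LowerSemicontinuous φ) (hbdd : ∃ B, ∀ z, B ≤ φ z) {g : X → Y} {x u : X}
    (hg : ∀ᶠ x' in 𝓝 x, DifferentiableAt ℝ g x')
    (hu : u ∈ realRegSubdiff (fun x' => φ (g x')) x) {ε : ℝ} (hε : 0 < ε) :
    ∃ x' z' v, dist x' x < ε ∧ dist z' (g x) < ε ∧ dist (φ z') (φ (g x)) < ε ∧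
      v ∈ realRegSubdiff φ z' ∧
      dist (ContinuousLinearMap.adjoint (fderiv ℝ g x') v) u < ε := by
  obtain ⟨B, hB⟩ := hbdd
  obtain ⟨η, hη⟩ : ∃ η, η = ε / 4 := ⟨_, rfl⟩
  have hη0 : 0 < η := by rw [hη]; positivity
  obtain ⟨r, hr, hball⟩ := Metric.nhds_basis_closedBall.eventually_iff.1 (hg.and (hu η hη0))
  set C : Set (X × Y) := Metric.closedBall x r ×ˢ Metric.closedBall (g x) 1 with hC
  have hCc : IsCompact C := (isCompact_closedBall _ _).prod (isCompact_closedBall _ _)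
  have h0C : (x, g x) ∈ C :=
    ⟨Metric.mem_closedBall_self hr.le, Metric.mem_closedBall_self zero_le_one⟩
  have hgc : ContinuousOn g (Metric.closedBall x r) := fun x' hx' =>
    (hball hx').1.continuousAt.continuousWithinAt
  have hgC : ContinuousOn (fun p : X × Y => g p.1) C :=
    hgc.comp continuousOn_fst fun p hp => hp.1
  -- Since `u` supports the composition up to slope `η`, the slope `2 * η` makes `x` the strict
  -- minimizer of `φ ∘ g + s` on the ball. Penalized minimizers therefore converge to `(x, g x)`,
  -- and the perturbation costs an error of at most `2 * η = ε / 2` in the adjoint equation.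
  let s : X → ℝ := fun x' => -inner ℝ u (x' - x) + 2 * η * ‖x' - x‖
  have hs : Continuous s := by fun_prop
  have hs0 : s x = 0 := by simp [s]
  have hmin : ∀ k : ℕ, ∃ p ∈ C, ∀ q ∈ C, φ p.2 + (s p.1 + (k : ℝ) / 2 * ‖p.2 - g p.1‖ ^ 2) ≤
      φ q.2 + (s q.1 + (k : ℝ) / 2 * ‖q.2 - g q.1‖ ^ 2) := by
    intro k
    obtain ⟨p, hp, hp'⟩ := LowerSemicontinuousOn.exists_isMinOn ⟨_, h0C⟩ hCc
      (f := fun p : X × Y => φ p.2 + (s p.1 + (k : ℝ) / 2 * ‖p.2 - g p.1‖ ^ 2)) (by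
        refine LowerSemicontinuousOn.add ?_ (ContinuousOn.lowerSemicontinuousOn ?_)
        · exact (hlsc.comp continuous_snd).lowerSemicontinuousOn C
        · exact (hs.comp continuous_fst).continuousOn.add (continuousOn_const.mul
            ((continuousOn_snd.sub hgC).norm.pow 2)))
    exact ⟨p, hp, fun q hq => hp' hq⟩
  choose p hpC hpmin using hmin
  have hval : ∀ k, φ (p k).2 + (s (p k).1 + (k : ℝ) / 2 * ‖(p k).2 - g (p k).1‖ ^ 2) ≤
      φ (g x) := fun k => by simpa [hs0] using hpmin k _ h0C
  have hsle : ∀ k, φ (p k).2 ≤ φ (g x) - s (p k).1 := fun k => by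
    have : 0 ≤ (k : ℝ) / 2 * ‖(p k).2 - g (p k).1‖ ^ 2 := by positivity
    linarith [hval k]
  have hslow : ∀ x' ∈ Metric.closedBall x r, -(‖u‖ * r) ≤ s x' := by
    intro x' hx'
    have h1 := real_inner_le_norm u (x' - x)
    have h2 : ‖x' - x‖ ≤ r := by rw [← dist_eq_norm]; exact hx'
    have h3 := mul_le_mul_of_nonneg_left h2 (norm_nonneg u)
    have h4 : 0 ≤ 2 * η * ‖x' - x‖ := by positivity
    simp only [s]
    linarith
  have hres : Tendsto (fun k => ‖(p k).2 - g (p k).1‖ ^ 2) atTop (𝓝 0) := by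
    have hlim : Tendsto (fun k : ℕ => 2 * (φ (g x) - B + ‖u‖ * r) / (k : ℝ)) atTop (𝓝 0) :=
      tendsto_const_div_atTop_nhds_zero_nat _
    refine tendsto_of_tendsto_of_tendsto_of_le_of_le' tendsto_const_nhds hlim
      (Eventually.of_forall fun _ => by positivity) ?_
    filter_upwards [eventually_gt_atTop 0] with k hk
    have hk' : (0 : ℝ) < k := Nat.cast_pos.2 hk
    rw [le_div_iff₀ hk']
    linarith [hval k, hB (p k).2, hslow _ (hpC k).1]
  have hlim : Tendsto p atTop (𝓝 (x, g x)) := by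
    refine hCc.tendsto_nhds_of_unique_mapClusterPt (Eventually.of_forall hpC) ?_
    rintro ⟨x', z'⟩ hC' hcl
    obtain ⟨U, hU, hpU⟩ := mapClusterPt_iff_ultrafilter.1 hcl
    have h1 : Tendsto (fun k => (p k).1) U (𝓝 x') := (continuous_fst.tendsto _).comp hpU
    have h2 : Tendsto (fun k => (p k).2) U (𝓝 z') := (continuous_snd.tendsto _).comp hpU
    have h3 : Tendsto (fun k => g (p k).1) U (𝓝 (g x')) :=
      ((hball hC'.1).1.continuousAt.tendsto).comp h1
    have h4 : ‖z' - g x'‖ ^ 2 = 0 :=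
      tendsto_nhds_unique ((h2.sub h3).norm.pow 2) (hres.mono_left hU)
    have h5 : z' = g x' := sub_eq_zero.1 (norm_eq_zero.1 (pow_eq_zero_iff two_ne_zero |>.1 h4))
    have h6 : φ z' ≤ φ (g x) - s x' := le_of_lowerSemicontinuous_of_tendsto hlsc h2
      (tendsto_const_nhds.sub ((hs.tendsto x').comp h1)) (Eventually.of_forall hsle)
    have h7 := (hball hC'.1).2
    rw [h5] at h6
    simp only [s] at h6
    have h8 : ‖x' - x‖ = 0 := by nlinarith [norm_nonneg (x' - x)]
    have h9 : x' = x := sub_eq_zero.1 (norm_eq_zero.1 h8)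
    rw [h5, h9]
  have hl1 : Tendsto (fun k => (p k).1) atTop (𝓝 x) := (continuous_fst.tendsto _).comp hlim
  have hl2 : Tendsto (fun k => (p k).2) atTop (𝓝 (g x)) := (continuous_snd.tendsto _).comp hlim
  have hup : ∀ᶠ k in atTop, φ (p k).2 < φ (g x) + ε := by
    have : Tendsto (fun k => φ (g x) - s (p k).1) atTop (𝓝 (φ (g x) - s x)) :=
      tendsto_const_nhds.sub ((hs.tendsto x).comp hl1)
    rw [hs0, sub_zero] at this
    filter_upwards [this.eventually (gt_mem_nhds (lt_add_of_pos_right _ hε))] with k hk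
    exact (hsle k).trans_lt hk
  obtain ⟨k, a1, a2, a3, a4, a5, a6⟩ := ((Metric.tendsto_nhds.1 hl1 ε hε).and
    ((Metric.tendsto_nhds.1 hl2 ε hε).and (hup.and
    ((hl2.eventually (hlsc (g x) _ (sub_lt_self _ hε))).and
    ((Metric.tendsto_nhds.1 hl1 r hr).and (Metric.tendsto_nhds.1 hl2 1 one_pos)))))).exists
  refine ⟨(p k).1, (p k).2, -((k : ℝ) • ((p k).2 - g (p k).1)), a1, a2, ?_, ?_, ?_⟩
  · rw [Real.dist_eq, abs_lt]
    constructor <;> linarith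
  · refine neg_smul_mem_realRegSubdiff ?_
    filter_upwards [Metric.isOpen_ball.mem_nhds (Metric.mem_ball.2 a6)] with z' hz'
    have := hpmin k ((p k).1, z') ⟨(hpC k).1, Metric.ball_subset_closedBall hz'⟩
    simp only at this
    linarith
  · have hd := hasFDerivAt_penalty (x₀ := x) (u := u) (z := (p k).2) (κ := k)
      (hball (hpC k).1).1.hasFDerivAt
    have h := norm_fderiv_le_of_eventually (η := 2 * η) (by positivity) hd (by
      filter_upwards [Metric.isOpen_ball.mem_nhds (Metric.mem_ball.2 a5)] with x' hx'
      have h1 := hpmin k (x', (p k).2) ⟨Metric.ball_subset_closedBall hx', (hpC k).2⟩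
      simp only [s] at h1
      have h2 : ‖x' - x‖ ≤ ‖x' - (p k).1‖ + ‖(p k).1 - x‖ := norm_sub_le_norm_sub_add_norm_sub ..
      nlinarith [mul_le_mul_of_nonneg_left h2 hη0.le])
    rw [innerSL_apply_norm] at h
    rw [dist_eq_norm]
    linarith

end Calculus

/-! ### Quadratic support and compactness of multipliers -/

section Multipliers

variable {X Y : Type*} [NormedAddCommGroup X] [InnerProductSpace ℝ X]
  [NormedAddCommGroup Y] [InnerProductSpace ℝ Y] {φ : Y → ℝ} {cbar : Y} {β K δ : ℝ}

theorem IsProxTruncation.ineq_limiting (hφ : IsProxTruncation φ cbar β K δ) {z z' v : Y}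
    (hz : z ∈ Metric.ball cbar δ) (hz' : z' ∈ Metric.ball cbar δ) (hzβ : φ z < β)
    (hzβ' : φ z' < β) (hv : v ∈ realSubdiff φ z) :
    inner ℝ v (z' - z) - (φ z' - φ z) ≤
      K * (1 + ‖v‖) * (‖z' - z‖ ^ 2 + (φ z' - φ z) ^ 2) := by
  obtain ⟨zs, vs, h1, h2, h3, h4⟩ := exists_seq_of_mem_realSubdiff hv
  refine le_of_tendsto_of_tendsto
    ((h4.inner (tendsto_const_nhds.sub h1)).sub (tendsto_const_nhds.sub h2))
    (((h4.norm.const_add 1).const_mul K).mul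
      (((tendsto_const_nhds.sub h1).norm.pow 2).add ((tendsto_const_nhds.sub h2).pow 2))) ?_
  filter_upwards [h1.eventually (Metric.isOpen_ball.mem_nhds hz),
    h2.eventually (gt_mem_nhds hzβ)] with j a1 a2
  exact hφ.ineq _ a1 _ hz' a2 hzβ' _ (h3 j)

/-- Uniform quadratic support: the limiting subgradients of norm at most `V` at points attentively
near `cbar` support `φ` near `cbar` up to a quadratic of curvature `ρ`. -/
def HasQuadSupport (φ : Y → ℝ) (cbar : Y) (V ρ δ : ℝ) : Prop :=
  ∀ z ∈ Metric.ball cbar δ, φ z < φ cbar + δ → ∀ v ∈ realSubdiff φ z, ‖v‖ ≤ V →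
    ∀ z' ∈ Metric.ball cbar δ, φ z + inner ℝ v (z' - z) - ρ / 2 * ‖z' - z‖ ^ 2 ≤ φ z'

theorem tendsto_clm_apply {ι : Type*} {l : Filter ι} {T : ι → Y →L[ℝ] X} {T₀ : Y →L[ℝ] X}
    {u : ι → Y} {u₀ : Y} (hT : Tendsto T l (𝓝 T₀)) (hu : Tendsto u l (𝓝 u₀)) :
    Tendsto (fun i => T i (u i)) l (𝓝 (T₀ u₀)) :=
  (isBoundedBilinearMap_apply.continuous.tendsto (T₀, u₀)).comp (hT.prodMk_nhds hu)

/-- Only `τ < s` matters. Then `τ ≤ V * w`, and if `τ < 0` the smallness of `K' * δ₁` absorbs the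
square of `τ` into its linear term. Hence `|τ| ≤ 2 * (V + 1) * w`, which turns the quadratic in `τ`
into one in `w`. -/
theorem sub_le_of_quadratic_bound {V K' δ₁ w s τ : ℝ} (hV : 0 ≤ V) (hK : 0 ≤ K')
    (hKδ : K' * δ₁ ≤ 1 / 8) (hw : 0 ≤ w) (hwδ : w ≤ 2 * δ₁) (hs : s ≤ V * w)
    (hs' : -(V * w) ≤ s) (hτ : -(2 * δ₁) ≤ τ) (h : s - τ ≤ K' * (w ^ 2 + τ ^ 2)) :
    s - τ ≤ K' * (1 + 4 * (V + 1) ^ 2) * w ^ 2 := by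
  have hVw : 0 ≤ V * w := mul_nonneg hV hw
  rcases le_or_gt s τ with hneg | hpos
  · have : 0 ≤ K' * (1 + 4 * (V + 1) ^ 2) * w ^ 2 := by positivity
    linarith
  have hup : τ ≤ 2 * (V + 1) * w := by linarith
  have hdown : -(2 * (V + 1) * w) ≤ τ := by
    rcases le_or_gt 0 τ with h0 | h0
    · linarith
    have b1 : K' * w ≤ 1 := by linarith [mul_le_mul_of_nonneg_left hwδ hK]
    have b2 := mul_le_mul_of_nonneg_right b1 hw
    have b3 : K' * (-τ) ≤ 1 / 2 := by
      linarith [mul_le_mul_of_nonneg_left (show -τ ≤ 2 * δ₁ by linarith) hK]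
    have b4 := mul_le_mul_of_nonneg_right b3 (neg_nonneg.2 h0.le)
    have e : K' * (w ^ 2 + τ ^ 2) = K' * w * w + K' * (-τ) * (-τ) := by ring
    linarith
  have hτ2 : τ ^ 2 ≤ (2 * (V + 1) * w) ^ 2 := sq_le_sq' hdown hup
  calc _ ≤ K' * (w ^ 2 + τ ^ 2) := h
    _ ≤ K' * (w ^ 2 + (2 * (V + 1) * w) ^ 2) :=
      mul_le_mul_of_nonneg_left (by linarith) hK
    _ = _ := by ring

theorem IsProxTruncation.exists_quadSupport (hφ : IsProxTruncation φ cbar β K δ) {V : ℝ}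
    (hV : 0 ≤ V) : ∃ ρ ≥ 0, ∃ δ' > 0, HasQuadSupport φ cbar V ρ δ' := by
  obtain ⟨K', hK'⟩ : ∃ K', K' = K * (1 + V) := ⟨_, rfl⟩
  have hK0 : 0 ≤ K' := by rw [hK']; exact mul_nonneg hφ.nonneg (by linarith)
  obtain ⟨δ₁, hδ₁⟩ : ∃ δ₁, δ₁ = 1 / (8 * (K' + 1)) := ⟨_, rfl⟩
  have hδ₁0 : 0 < δ₁ := by rw [hδ₁]; positivity
  have hKδ : K' * δ₁ ≤ 1 / 8 := by
    rw [hδ₁, mul_one_div, div_le_div_iff₀ (by positivity) (by norm_num)]; linarith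
  obtain ⟨δ₂, hδ₂, hlow⟩ := Metric.eventually_nhds_iff_ball.1
    (hφ.lsc cbar _ (sub_lt_self (φ cbar) hδ₁0))
  have hgap : 0 < β - φ cbar := sub_pos.2 hφ.lt
  -- The last condition handles truncated points: if `φ z' = β`, the affine minorant is at most `φ
  -- cbar + δ' * (1 + 2 * V)`, already below `β`.
  obtain ⟨δ', hδ'0, h1, h2, h3, h4⟩ : ∃ δ' > 0, δ' ≤ δ₁ ∧ δ' ≤ δ₂ ∧ δ' ≤ δ ∧
      δ' * (1 + 2 * V) < β - φ cbar := by
    refine ⟨min (min δ₁ δ₂) (min δ ((β - φ cbar) / (2 * (1 + 2 * V)))),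
      lt_min (lt_min hδ₁0 hδ₂) (lt_min hφ.pos (by positivity)),
      (min_le_left _ _).trans (min_le_left _ _), (min_le_left _ _).trans (min_le_right _ _),
      (min_le_right _ _).trans (min_le_left _ _), ?_⟩
    have : min (min δ₁ δ₂) (min δ ((β - φ cbar) / (2 * (1 + 2 * V)))) ≤
        (β - φ cbar) / (2 * (1 + 2 * V)) := (min_le_right _ _).trans (min_le_right _ _)
    calc _ ≤ (β - φ cbar) / (2 * (1 + 2 * V)) * (1 + 2 * V) :=
          mul_le_mul_of_nonneg_right this (by linarith)
      _ = (β - φ cbar) / 2 := by field_simp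
      _ < _ := by linarith
  refine ⟨2 * (K' * (1 + 4 * (V + 1) ^ 2)), by positivity, δ', hδ'0, ?_⟩
  intro z hz hzφ v hv hvV z' hz'
  have hw2 : ‖z' - z‖ < 2 * δ' := by
    rw [← dist_eq_norm]
    have a1 := Metric.mem_ball.1 hz
    have a2 := Metric.mem_ball.1 hz'
    have a3 := dist_triangle_right z' z cbar
    linarith
  have hinner : inner ℝ v (z' - z) ≤ V * ‖z' - z‖ :=
    (real_inner_le_norm _ _).trans (mul_le_mul_of_nonneg_right hvV (norm_nonneg _))
  have hinner' : -(V * ‖z' - z‖) ≤ inner ℝ v (z' - z) := by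
    have a1 := abs_real_inner_le_norm v (z' - z)
    have a2 := mul_le_mul_of_nonneg_right hvV (norm_nonneg (z' - z))
    linarith [neg_abs_le (inner ℝ v (z' - z))]
  have hwn := norm_nonneg (z' - z)
  set w := ‖z' - z‖ with hw
  have hC : 0 ≤ K' * (1 + 4 * (V + 1) ^ 2) * w ^ 2 := by positivity
  have hδV : 0 ≤ δ' * V := by positivity
  have hzβ : φ z < β := by linarith
  rcases (hφ.le z').eq_or_lt with heq | hlt
  · rw [heq]
    have := mul_le_mul_of_nonneg_left hw2.le hV
    linarith
  have hineq := hφ.ineq_limiting (Metric.ball_subset_ball h3 hz) (Metric.ball_subset_ball h3 hz')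
    hzβ hlt hv
  have hl := hlow z' (Metric.ball_subset_ball h2 hz')
  set τ := φ z' - φ z with hτ
  have hτlow : -(2 * δ₁) ≤ τ := by linarith
  have hK2 : K * (1 + ‖v‖) ≤ K' := by
    rw [hK']; exact mul_le_mul_of_nonneg_left (by linarith) hφ.nonneg
  have hineq' : inner ℝ v (z' - z) - τ ≤ K' * (w ^ 2 + τ ^ 2) :=
    hineq.trans (mul_le_mul_of_nonneg_right hK2 (by positivity))
  have := sub_le_of_quadratic_bound hV hK0 hKδ hwn (by linarith) hinner hinner' hτlow hineq'
  linarith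

/-- It suffices to check quadratic support for regular subgradients with a slightly larger
bound. -/
theorem HasQuadSupport.of_regular {V ρ δ' : ℝ}
    (H : ∀ z ∈ Metric.ball cbar δ', φ z < φ cbar + δ' → ∀ v ∈ realRegSubdiff φ z, ‖v‖ < V + 1 →
      ∀ z' ∈ Metric.ball cbar δ', φ z + inner ℝ v (z' - z) - ρ / 2 * ‖z' - z‖ ^ 2 ≤ φ z') :
    HasQuadSupport φ cbar V ρ δ' := by
  intro z hz hzφ v hv hvV z' hz'
  obtain ⟨zs, vs, h1, h2, h3, h4⟩ := exists_seq_of_mem_realSubdiff hv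
  refine le_of_tendsto ((h2.add (h4.inner (tendsto_const_nhds.sub h1))).sub
    ((((tendsto_const_nhds (x := z')).sub h1).norm.pow 2).const_mul (ρ / 2))) ?_
  filter_upwards [h1.eventually (Metric.isOpen_ball.mem_nhds hz),
    h2.eventually (gt_mem_nhds hzφ),
    h4.norm.eventually (gt_mem_nhds (lt_of_le_of_lt hvV (lt_add_one V)))] with j a1 a2 a3
  exact H _ a1 a2 _ (h3 j) a3 z' hz'

/-- Horizon directions may be added to subgradients. -/
theorem IsProxTruncation.add_mem_realSubdiff (hφ : IsProxTruncation φ cbar β K δ) {v₀ w : Y}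
    (hv₀ : v₀ ∈ realSubdiff φ cbar) {zs vs : ℕ → Y} (hz : Tendsto zs atTop (𝓝 cbar))
    (hφz : Tendsto (fun j => φ (zs j)) atTop (𝓝 (φ cbar)))
    (hv : ∀ j, vs j ∈ realSubdiff φ (zs j))
    (hpos : ∀ᶠ j in atTop, 0 < ‖vs j‖)
    (hinf : Tendsto (fun j => ‖vs j‖⁻¹) atTop (𝓝 0))
    (hw : Tendsto (fun j => ‖vs j‖⁻¹ • vs j) atTop (𝓝 w)) :
    v₀ + w ∈ realSubdiff φ cbar := by
  -- Dividing the prox-regularity inequality by `‖vs j‖` removes the linear term in `φ` in the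
  -- limit; this survives because the right-hand side grows only linearly in `‖v‖`.
  have hhor : ∀ z' ∈ Metric.ball cbar δ, φ z' < β →
      inner ℝ w (z' - cbar) ≤ K * (‖z' - cbar‖ ^ 2 + (φ z' - φ cbar) ^ 2) := by
    intro z' hz' hz'β
    have hl := (hw.inner ((tendsto_const_nhds (x := z')).sub hz)).sub
      (hinf.mul ((tendsto_const_nhds (x := φ z')).sub hφz))
    rw [zero_mul, sub_zero] at hl
    have hr := ((hinf.add_const 1).const_mul K).mul
      ((((tendsto_const_nhds (x := z')).sub hz).norm.pow 2).add
        (((tendsto_const_nhds (x := φ z')).sub hφz).pow 2))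
    rw [zero_add, mul_one] at hr
    refine le_of_tendsto_of_tendsto hl hr ?_
    filter_upwards [hz.eventually (Metric.isOpen_ball.mem_nhds (Metric.mem_ball_self hφ.pos)),
      hφz.eventually (gt_mem_nhds hφ.lt), hpos] with j a1 a2 a3
    have h1 := mul_le_mul_of_nonneg_left (hφ.ineq_limiting a1 hz' a2 hz'β (hv j))
      (inv_nonneg.2 a3.le)
    rw [real_inner_smul_left]
    have e : ‖vs j‖⁻¹ * (K * (1 + ‖vs j‖) * (‖z' - zs j‖ ^ 2 + (φ z' - φ (zs j)) ^ 2)) =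
        K * (‖vs j‖⁻¹ + 1) * (‖z' - zs j‖ ^ 2 + (φ z' - φ (zs j)) ^ 2) := by
      field_simp
    rw [e] at h1
    linarith
  obtain ⟨ρ, hρ, δ', hδ', hq⟩ := hφ.exists_quadSupport (norm_nonneg v₀)
  refine realRegSubdiff_subset _ _ fun ε hε => ?_
  obtain ⟨C, hC⟩ : ∃ C, C = ‖v₀‖ + ‖w‖ + ρ + 1 := ⟨_, rfl⟩
  have hC0 : 0 < C := by rw [hC]; positivity
  obtain ⟨M, hM⟩ : ∃ M, M = K * (1 + C ^ 2) + ρ := ⟨_, rfl⟩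
  have hM0 : 0 ≤ M := by
    rw [hM]; have := hφ.nonneg; positivity
  have hgap : 0 < β - φ cbar := sub_pos.2 hφ.lt
  have hlim : Tendsto (fun z' => ‖z' - cbar‖) (𝓝 cbar) (𝓝 0) := by
    have : Continuous fun z' => ‖z' - cbar‖ := by fun_prop
    simpa using this.tendsto cbar
  filter_upwards [Metric.ball_mem_nhds cbar hφ.pos, Metric.ball_mem_nhds cbar hδ',
    hlim.eventually (gt_mem_nhds one_pos),
    hlim.eventually (gt_mem_nhds (show 0 < ε / (M + 1) by positivity)),
    hlim.eventually (gt_mem_nhds (show 0 < (β - φ cbar) / C by positivity))]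
    with z' a1 a2 a3 a4 a5
  have h1 := hq cbar (Metric.mem_ball_self hδ') (by linarith) v₀ hv₀ le_rfl z' a2
  have hwn := norm_nonneg (z' - cbar)
  have b1 := real_inner_le_norm v₀ (z' - cbar)
  have b1' := abs_le.1 (abs_real_inner_le_norm v₀ (z' - cbar))
  have b2 := real_inner_le_norm w (z' - cbar)
  rw [inner_add_left]
  have a4' : ‖z' - cbar‖ * (M + 1) < ε := (lt_div_iff₀ (by positivity)).1 a4
  have a5' : ‖z' - cbar‖ * C < β - φ cbar := (lt_div_iff₀ hC0).1 a5
  set s := ‖z' - cbar‖ with hs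
  have hs2 : s ^ 2 ≤ s := by nlinarith
  have hεs : 0 ≤ ε * s := by positivity
  -- If `φ z'` rises at rate at least `C`, the inequality follows from Cauchy–Schwarz. Otherwise `|φ
  -- z' - φ cbar| ≤ C * s`, and the horizon inequality has error `O(s ^ 2)`.
  rcases le_or_gt (φ cbar + C * s) (φ z') with hbig | hsmall
  · have : (‖v₀‖ + ‖w‖) * s ≤ C * s := mul_le_mul_of_nonneg_right (by linarith) hwn
    linarith
  have h2 := hhor z' a1 (by linarith)
  have h3 : (φ z' - φ cbar) ^ 2 ≤ (C * s) ^ 2 := by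
    refine sq_le_sq' ?_ (by linarith)
    have : ρ / 2 * s ^ 2 ≤ ρ * s := by nlinarith
    have e : C * s = ‖v₀‖ * s + ‖w‖ * s + ρ * s + s := by rw [hC]; ring
    have : 0 ≤ ‖w‖ * s := by positivity
    linarith [b1'.1]
  have h4 : inner ℝ w (z' - cbar) ≤ K * (1 + C ^ 2) * s ^ 2 := by
    have := mul_le_mul_of_nonneg_left (add_le_add_right h3 (s ^ 2)) hφ.nonneg
    nlinarith
  have h5 : (K * (1 + C ^ 2) + ρ / 2) * s ^ 2 ≤ ε * s := by
    have : (K * (1 + C ^ 2) + ρ / 2) * s ≤ ε := by nlinarith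
    nlinarith
  linarith

section Compactness

variable [ProperSpace Y] {A : X → Y →L[ℝ] X} {xbar : X}

/-- Bounded sequences of approximate multipliers have subsequences converging to multipliers. -/
theorem exists_subseq_tendsto_multiplier (hA : ContinuousAt A xbar) {xs : ℕ → X} {zs vs : ℕ → Y}
    (hx : Tendsto xs atTop (𝓝 xbar)) (hz : Tendsto zs atTop (𝓝 cbar))
    (hφz : Tendsto (fun j => φ (zs j)) atTop (𝓝 (φ cbar)))
    (hv : ∀ j, vs j ∈ realSubdiff φ (zs j)) {V : ℝ} (hV : ∀ j, ‖vs j‖ ≤ V)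
    {a : X}
    (hAv : Tendsto (fun j => A (xs j) (vs j)) atTop (𝓝 a)) :
    ∃ v ∈ realSubdiff φ cbar, A xbar v = a ∧ ∃ ψ : ℕ → ℕ, StrictMono ψ ∧
      Tendsto (vs ∘ ψ) atTop (𝓝 v) := by
  obtain ⟨v, -, ψ, hψ, hlim⟩ := tendsto_subseq_of_bounded
    (Metric.isBounded_closedBall (x := (0 : Y)) (r := V)) (x := vs)
    (fun j => mem_closedBall_zero_iff.2 (hV j))
  have hψ' := hψ.tendsto_atTop
  refine ⟨v, mem_realSubdiff_of_tendsto (hz.comp hψ') (hφz.comp hψ')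
    (Eventually.of_forall fun j => hv (ψ j)) hlim, ?_, ψ, hψ, hlim⟩
  exact tendsto_nhds_unique (tendsto_clm_apply ((hA.tendsto.comp hx).comp hψ') hlim) (hAv.comp hψ')

/-- Approximate multipliers near the reference point are uniformly bounded. -/
theorem IsProxTruncation.exists_multiplier_bound (hφ : IsProxTruncation φ cbar β K δ)
    (hA : ContinuousAt A xbar) (hne : (realSubdiff φ cbar).Nonempty)
    (hli : ∀ v₁ ∈ realSubdiff φ cbar, ∀ v₂ ∈ realSubdiff φ cbar, A xbar (v₁ - v₂) = 0 →
      v₁ = v₂) :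
    ∃ V ≥ 0, ∃ δ' > 0, ∀ x ∈ Metric.ball xbar δ', ∀ z ∈ Metric.ball cbar δ',
      dist (φ z) (φ cbar) < δ' → ∀ v ∈ realSubdiff φ z, ‖A x v‖ ≤ 1 → ‖v‖ ≤ V := by
  by_contra! hcon
  obtain ⟨u, e, hu, he⟩ := exists_seq_of_forall_pos
    (P := fun ε (p : X × Y × Y) => dist p.1 xbar < ε ∧ dist p.2.1 cbar < ε ∧
      dist (φ p.2.1) (φ cbar) < ε ∧ p.2.2 ∈ realSubdiff φ p.2.1 ∧ ‖A p.1 p.2.2‖ ≤ 1 ∧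
      0 < ‖p.2.2‖ ∧ ‖p.2.2‖⁻¹ < ε)
    (fun ε hε => by
      obtain ⟨x, hx, z, hz, h1, v, hv, h2, h3⟩ := hcon ε⁻¹ (inv_nonneg.2 hε.le) ε hε
      have hvp : 0 < ‖v‖ := (inv_pos.2 hε).trans h3
      exact ⟨(x, z, v), hx, hz, h1, hv, h2, hvp, inv_lt_of_inv_lt₀ hε h3⟩)
  obtain ⟨v₀, hv₀⟩ := hne
  have hx : Tendsto (fun j => (u j).1) atTop (𝓝 xbar) := tendsto_of_dist_lt (fun j => (hu j).1) he
  have hz : Tendsto (fun j => (u j).2.1) atTop (𝓝 cbar) :=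
    tendsto_of_dist_lt (fun j => (hu j).2.1) he
  have hφz : Tendsto (fun j => φ (u j).2.1) atTop (𝓝 (φ cbar)) :=
    tendsto_of_dist_lt (fun j => (hu j).2.2.1) he
  have hinv : Tendsto (fun j => ‖(u j).2.2‖⁻¹) atTop (𝓝 0) :=
    squeeze_zero (fun j => by positivity) (fun j => (hu j).2.2.2.2.2.2.le) he
  have hn1 : ∀ j, ‖‖(u j).2.2‖⁻¹ • (u j).2.2‖ = 1 := fun j => by
    rw [norm_smul, norm_inv, norm_norm, inv_mul_cancel₀ (hu j).2.2.2.2.2.1.ne']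
  obtain ⟨w, hwS, ψ, hψ, hw⟩ := (isCompact_sphere (0 : Y) 1).tendsto_subseq
    (x := fun j => ‖(u j).2.2‖⁻¹ • (u j).2.2) (fun j => mem_sphere_zero_iff_norm.2 (hn1 j))
  have hψ' := hψ.tendsto_atTop
  -- Both `v₀ + w` and `v₀` are subgradients at `cbar`, so transversality applies to their
  -- difference `w`, a unit vector in the kernel of `A xbar`.
  have hmem := hφ.add_mem_realSubdiff hv₀ (hz.comp hψ') (hφz.comp hψ')
    (vs := fun j => (u (ψ j)).2.2) (fun j => (hu (ψ j)).2.2.2.1)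
    (Eventually.of_forall fun j => (hu (ψ j)).2.2.2.2.2.1) (hinv.comp hψ') hw
  have hAw : A xbar w = 0 := by
    refine tendsto_nhds_unique (tendsto_clm_apply ((hA.tendsto.comp hx).comp hψ') hw) ?_
    refine squeeze_zero_norm (fun j => ?_) (hinv.comp hψ')
    simp only [Function.comp, map_smul, norm_smul, norm_inv, norm_norm]
    exact mul_le_of_le_one_right (by positivity) (hu (ψ j)).2.2.2.2.1
  have h0 := hli _ hmem _ hv₀ (by rwa [add_sub_cancel_left])
  have hw0 : w = 0 := by simpa using h0
  rw [mem_sphere_zero_iff_norm, hw0, norm_zero] at hwS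
  exact zero_ne_one hwS

/-- Approximate multipliers are close to the unique multiplier. -/
theorem multiplier_close (hA : ContinuousAt A xbar) {V δ' : ℝ} (hδ' : 0 < δ')
    (hV : ∀ x ∈ Metric.ball xbar δ', ∀ z ∈ Metric.ball cbar δ',
      dist (φ z) (φ cbar) < δ' → ∀ v ∈ realSubdiff φ z, ‖A x v‖ ≤ 1 → ‖v‖ ≤ V) {vbar : Y}
    (huniq : ∀ v ∈ realSubdiff φ cbar, A xbar v = 0 → v = vbar) {xs : ℕ → X} {zs vs : ℕ → Y}
    (hx : Tendsto xs atTop (𝓝 xbar)) (hz : Tendsto zs atTop (𝓝 cbar))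
    (hφz : Tendsto (fun j => φ (zs j)) atTop (𝓝 (φ cbar)))
    (hv : ∀ᶠ j in atTop, vs j ∈ realSubdiff φ (zs j))
    (hAv : Tendsto (fun j => A (xs j) (vs j)) atTop (𝓝 0)) :
    Tendsto vs atTop (𝓝 vbar) := by
  -- Every subsequence has a further one converging to a multiplier, and `vbar` is the only possible
  -- limit.
  refine tendsto_of_subseq_tendsto fun ns hns => ?_
  have hev : ∀ᶠ j in atTop, vs j ∈ realSubdiff φ (zs j) ∧ ‖vs j‖ ≤ V := by
    have hn := hAv.norm
    rw [norm_zero] at hn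
    filter_upwards [hv, hx.eventually (Metric.ball_mem_nhds _ hδ'),
      hz.eventually (Metric.ball_mem_nhds _ hδ'), Metric.tendsto_nhds.1 hφz δ' hδ',
      hn.eventually (gt_mem_nhds one_pos)] with j a1 a2 a3 a4 a5
    exact ⟨a1, hV _ a2 _ a3 a4 _ a1 a5.le⟩
  obtain ⟨N, hN⟩ := eventually_atTop.1 (hns.eventually hev)
  have hsh : Tendsto (fun j => ns (j + N)) atTop atTop := hns.comp (tendsto_add_atTop_nat N)
  obtain ⟨v, h1, h2, ψ, hψ, h3⟩ := exists_subseq_tendsto_multiplier hA (hx.comp hsh)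
    (hz.comp hsh) (hφz.comp hsh) (vs := fun j => vs (ns (j + N)))
    (fun j => (hN _ (Nat.le_add_left _ _)).1) (fun j => (hN _ (Nat.le_add_left _ _)).2)
    (hAv.comp hsh)
  exact ⟨fun j => ψ j + N, by rw [← huniq v h1 h2]; exact h3⟩

end Compactness

end Multipliers

/-! ### Existence and uniqueness of steps by exact penalization -/

theorem sq_add_three_le (E m L t ε : ℝ) :
    (E + m + L * (t + ε)) ^ 2 ≤ 4 * E ^ 2 + 4 * m ^ 2 + 4 * L ^ 2 * t ^ 2 + 4 * L ^ 2 * ε ^ 2 := by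
  have h1 := sq_nonneg (E - m)
  have h2 := mul_nonneg (sq_nonneg L) (sq_nonneg (t - ε))
  have h3 := sq_nonneg (E + m - L * (t + ε))
  linarith

/-- Here `E` is the constraint violation, `t` the size of the step and `ε` that of the reference
step. Combining the two bounds on `F` gives `μ / 4 * t ^ 2 + E ≤ (μ / 2 + C) * ε ^ 2 + M * ε * t`.
The penalty `α ≥ b + 2` pays once for the multiplier term and once for the quadratic in `E`, with
one copy of `E` to spare; `8 * ρ * L ^ 2 ≤ μ` absorbs the curvature into half of the proximal term.
-/
theorem penalized_bounds {a b F Z E t ε μ μhat α M L ρ C : ℝ} (hE : 0 ≤ E)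
    (hε : 0 ≤ ε) (hε1 : ε ≤ 1) (hM : 0 ≤ M) (hb : 0 ≤ b) (hρ : 0 ≤ ρ) (hμhat : 0 < μhat)
    (hμ : μhat ≤ μ) (hρμ : 8 * ρ * L ^ 2 ≤ μ) (hα : b + 2 ≤ α) (hρE : 2 * ρ * E ≤ 1)
    (hC : C = (α + b + 1) * M + 2 * ρ * M ^ 2 + 2 * ρ * L ^ 2)
    (hup : F + μ / 2 * t ^ 2 + α * E ≤ a + μ / 2 * ε ^ 2 + α * (M * ε ^ 2))
    (hlow : a - b * (E + M * ε ^ 2) - M * ε * (t + ε) - ρ / 2 * Z ≤ F)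
    (hZ : Z ≤ 4 * E ^ 2 + 4 * (M * ε ^ 2) ^ 2 + 4 * L ^ 2 * t ^ 2 + 4 * L ^ 2 * ε ^ 2) :
    t ≤ (2 + 4 * (C + M) / μhat) * ε ∧
      E ≤ (μ / 2 + (C + M * (2 + 4 * (C + M) / μhat))) * ε ^ 2 ∧
      F ≤ a + (μ / 2 + C) * ε ^ 2 := by
  have hμ0 : 0 < μ := hμhat.trans_le hμ
  have hC0 : 0 ≤ C := by rw [hC]; have : 0 ≤ α := by linarith
                         positivity
  have hαM : α * M ≤ C := by
    have : 0 ≤ (b + 1) * M + 2 * ρ * M ^ 2 + 2 * ρ * L ^ 2 := by positivity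
    rw [hC]; linarith
  have hεε : ε ^ 2 * ε ^ 2 ≤ ε ^ 2 := mul_le_of_le_one_right (sq_nonneg _) (pow_le_one₀ hε hε1)
  have h1 : ρ / 2 * Z ≤ E + 2 * ρ * M ^ 2 * ε ^ 2 + μ / 4 * t ^ 2 + 2 * ρ * L ^ 2 * ε ^ 2 := by
    have c1 := mul_le_mul_of_nonneg_left hZ (by linarith : 0 ≤ ρ / 2)
    have c2 := mul_le_mul_of_nonneg_right hρE hE
    have c3 := mul_le_mul_of_nonneg_left hεε (by positivity : 0 ≤ 2 * ρ * M ^ 2)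
    have c4 := mul_le_mul_of_nonneg_right hρμ (sq_nonneg t)
    linarith
  have hmain : μ / 4 * t ^ 2 + E ≤ (μ / 2 + C) * ε ^ 2 + M * ε * t := by
    have c1 := mul_le_mul_of_nonneg_right hα hE
    rw [hC]
    linarith
  -- This makes the step constant independent of `μ`: the proximal cost `μ / 2` of the reference
  -- step scales with `μ`, and `C + M` is at most `μ * (C + M) / μhat`.
  have hC2 : μ / 2 + (C + M) ≤ μ / 4 * (2 + 4 * (C + M) / μhat) := by
    have : C + M ≤ μ * ((C + M) / μhat) := by
      rw [mul_div_assoc', le_div_iff₀ hμhat, mul_comm]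
      exact mul_le_mul_of_nonneg_right hμ (by linarith)
    have e : μ / 4 * (2 + 4 * (C + M) / μhat) = μ / 2 + μ * ((C + M) / μhat) := by ring
    linarith
  have hC22 : 2 ≤ 2 + 4 * (C + M) / μhat := by
    have : 0 ≤ 4 * (C + M) / μhat := by positivity
    linarith
  have hA : t ≤ (2 + 4 * (C + M) / μhat) * ε := by
    generalize 2 + 4 * (C + M) / μhat = C₂ at *
    by_contra! hcon
    have hεt : ε ≤ t := by
      have := mul_le_mul_of_nonneg_right hC22 hε
      linarith
    have ht0 : 0 < t := lt_of_le_of_lt (by positivity) hcon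
    have c1 : (μ / 2 + C) * ε ^ 2 ≤ (μ / 2 + C) * (ε * t) :=
      mul_le_mul_of_nonneg_left (by rw [sq]; exact mul_le_mul_of_nonneg_left hεt hε)
        (by positivity)
    have c2 : t * (μ / 4 * t) ≤ t * ((μ / 2 + (C + M)) * ε) := by linarith
    have c3 := le_of_mul_le_mul_left c2 ht0
    have c4 := mul_le_mul_of_nonneg_right hC2 hε
    have c5 : μ / 4 * (C₂ * ε) < μ / 4 * t := mul_lt_mul_of_pos_left hcon (by positivity)
    linarith
  refine ⟨hA, ?_, ?_⟩
  · have c1 := mul_le_mul_of_nonneg_left hA (by positivity : 0 ≤ M * ε)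
    have c2 : 0 ≤ μ / 4 * t ^ 2 := by positivity
    linarith
  · have c1 := mul_le_mul_of_nonneg_right hαM (sq_nonneg ε)
    have c2 : 0 ≤ μ / 2 * t ^ 2 := by positivity
    have c3 : 0 ≤ α * E := mul_nonneg (by linarith) hE
    linarith

section Steps

variable {X Y : Type*} [NormedAddCommGroup X] [InnerProductSpace ℝ X] [ProperSpace X]
  [NormedAddCommGroup Y] [InnerProductSpace ℝ Y] [ProperSpace Y] {φ : Y → ℝ} {cbar vbar : Y}

open ContinuousLinearMap in
/-- Size estimates for penalized steps that are at least as good as the reference step. -/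
theorem penalized_step_bounds {y z : Y} {D : X →L[ℝ] Y} {p d : X}
    {μ μhat α M L ρ C C₂ δ₁ : ℝ}
    (hquad : φ cbar + inner ℝ vbar (z - cbar) - ρ / 2 * ‖z - cbar‖ ^ 2 ≤ φ z)
    (hM : 0 ≤ M) (hρ : 0 ≤ ρ) (hL : ‖D‖ ≤ L)
    (hp : ‖y + D p - cbar‖ ≤ M * ‖p‖ ^ 2) (hvbar : ‖adjoint D vbar‖ ≤ M * ‖p‖)
    (hp1 : ‖p‖ ≤ 1)
    (hρδ : 2 * ρ * (δ₁ + M * ‖p‖ ^ 2 + L * (δ₁ + ‖p‖)) ≤ 1)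
    (hμhat : 0 < μhat) (hμ : μhat ≤ μ) (hρμ : 8 * ρ * L ^ 2 ≤ μ)
    (hα : ‖vbar‖ + 2 ≤ α)
    (hC : C = (α + ‖vbar‖ + 1) * M + 2 * ρ * M ^ 2 + 2 * ρ * L ^ 2)
    (hC₂ : C₂ = 2 + 4 * (C + M) / μhat) (hd : ‖d‖ ≤ δ₁) (hzd : ‖z - cbar‖ ≤ δ₁)
    (hmin : φ z + (μ / 2 * ‖d‖ ^ 2 + α * ‖z - (y + D d)‖) ≤
      φ cbar + (μ / 2 * ‖p‖ ^ 2 + α * ‖cbar - (y + D p)‖)) :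
    ‖d‖ ≤ C₂ * ‖p‖ ∧ ‖z - cbar‖ ≤ ‖z - (y + D d)‖ + M * ‖p‖ ^ 2 + L * (‖d‖ + ‖p‖) ∧
      ‖z - (y + D d)‖ ≤ (μ / 2 + (C + M * C₂)) * ‖p‖ ^ 2 ∧
      φ z ≤ φ cbar + (μ / 2 + C) * ‖p‖ ^ 2 := by
  have hL0 : 0 ≤ L := (norm_nonneg D).trans hL
  have hb0 := norm_nonneg vbar
  have hα0 : 0 < α := by linarith
  have hp0 := norm_nonneg p
  have hDd : ∀ w, ‖D w‖ ≤ L * ‖w‖ := fun w =>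
    (D.le_opNorm w).trans (mul_le_mul_of_nonneg_right hL (norm_nonneg _))
  have hdp : ‖d - p‖ ≤ ‖d‖ + ‖p‖ := norm_sub_le _ _
  -- Constraint residual, defect of the reference step, and a vector in the range of `D`. On the
  -- last one `vbar` acts through `adjoint D vbar`, which is only `O(‖p‖)`.
  have hdecomp : z - cbar = (z - (y + D d)) + (y + D p - cbar) + D (d - p) := by
    rw [map_sub]; abel
  have hDdp : ‖D (d - p)‖ ≤ L * (‖d‖ + ‖p‖) :=
    (hDd _).trans (mul_le_mul_of_nonneg_left hdp hL0)
  have hznorm : ‖z - cbar‖ ≤ ‖z - (y + D d)‖ + M * ‖p‖ ^ 2 + L * (‖d‖ + ‖p‖) := by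
    rw [hdecomp]
    exact norm_add₃_le.trans (add_le_add (add_le_add le_rfl hp) hDdp)
  have hEbound : ‖z - (y + D d)‖ ≤ δ₁ + M * ‖p‖ ^ 2 + L * (δ₁ + ‖p‖) := by
    have e : z - (y + D d) = (z - cbar) - (y + D p - cbar) - D (d - p) := by
      rw [hdecomp]; abel
    have h1 : ‖z - (y + D d)‖ ≤ ‖z - cbar‖ + ‖y + D p - cbar‖ + ‖D (d - p)‖ := by
      rw [e]
      exact (norm_sub_le _ _).trans (add_le_add (norm_sub_le _ _) le_rfl)
    have h2 : L * (‖d‖ + ‖p‖) ≤ L * (δ₁ + ‖p‖) := mul_le_mul_of_nonneg_left (by linarith) hL0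
    linarith
  obtain ⟨hdC, hEC, hFC⟩ := penalized_bounds (a := φ cbar) (b := ‖vbar‖) (F := φ z)
    (Z := ‖z - cbar‖ ^ 2) (E := ‖z - (y + D d)‖) (t := ‖d‖) (ε := ‖p‖) (μ := μ) (μhat := μhat)
    (α := α) (M := M) (L := L) (ρ := ρ) (C := C) (norm_nonneg _) hp0 hp1 hM hb0
    hρ hμhat hμ hρμ hα
    ((mul_le_mul_of_nonneg_left hEbound (by positivity)).trans hρδ) hC
    (by
      have h1 := hmin
      rw [norm_sub_rev cbar] at h1
      have h2 := mul_le_mul_of_nonneg_left hp hα0.le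
      linarith)
    (by
      refine le_trans ?_ hquad
      have h1 : -(‖vbar‖ * (‖z - (y + D d)‖ + M * ‖p‖ ^ 2)) - M * ‖p‖ * (‖d‖ + ‖p‖) ≤
          inner ℝ vbar (z - cbar) := by
        rw [hdecomp, inner_add_right, ← adjoint_inner_left]
        have h2 := neg_le_of_abs_le (abs_real_inner_le_norm vbar
          ((z - (y + D d)) + (y + D p - cbar)))
        have h3 := neg_le_of_abs_le (abs_real_inner_le_norm (adjoint D vbar) (d - p))
        have h4 : ‖vbar‖ * ‖(z - (y + D d)) + (y + D p - cbar)‖ ≤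
            ‖vbar‖ * (‖z - (y + D d)‖ + M * ‖p‖ ^ 2) :=
          mul_le_mul_of_nonneg_left ((norm_add_le _ _).trans (add_le_add le_rfl hp)) hb0
        have h5 : ‖adjoint D vbar‖ * ‖d - p‖ ≤ M * ‖p‖ * (‖d‖ + ‖p‖) :=
          mul_le_mul hvbar hdp (norm_nonneg _) (by positivity)
        linarith
      linarith)
    (by
      have h1 := pow_le_pow_left₀ (norm_nonneg _) hznorm 2
      refine h1.trans ?_
      exact sq_add_three_le _ _ _ _ _)
  rw [← hC₂] at hdC hEC
  exact ⟨hdC, hznorm, hEC, hFC⟩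

open ContinuousLinearMap in
/-- Existence of proximal steps by exact penalization of the constraint `z = y + D d`. The vector
`p` is an approximately feasible step, with `y + D p` close to `cbar`. -/
theorem exists_local_min_step (hlsc : LowerSemicontinuous φ) {y : Y} {D : X →L[ℝ] Y} {p : X}
    {μ μhat α M L ρ C C₂ B δ₁ δ' V : ℝ}
    (hquad : ∀ z ∈ Metric.closedBall cbar δ₁,
      φ cbar + inner ℝ vbar (z - cbar) - ρ / 2 * ‖z - cbar‖ ^ 2 ≤ φ z)
    (hV : ∀ z ∈ Metric.ball cbar δ', dist (φ z) (φ cbar) < δ' → ∀ v ∈ realSubdiff φ z,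
      ‖adjoint D v‖ ≤ 1 → ‖v‖ ≤ V)
    (hM : 0 ≤ M) (hρ : 0 ≤ ρ) (hL : ‖D‖ ≤ L) (hV0 : 0 ≤ V)
    (hp : ‖y + D p - cbar‖ ≤ M * ‖p‖ ^ 2) (hvbar : ‖adjoint D vbar‖ ≤ M * ‖p‖)
    (hp1 : ‖p‖ ≤ 1) (hpδ : ‖p‖ ≤ δ₁) (hδ₁ : 0 < δ₁)
    (hρδ : 2 * ρ * (δ₁ + M * ‖p‖ ^ 2 + L * (δ₁ + ‖p‖)) ≤ 1)
    (hμhat : 0 < μhat) (hμ : μhat ≤ μ) (hρμ : 8 * ρ * L ^ 2 ≤ μ)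
    (hα : α = ‖vbar‖ + V + 2)
    (hC : C = (α + ‖vbar‖ + 1) * M + 2 * ρ * M ^ 2 + 2 * ρ * L ^ 2)
    (hC₂ : C₂ = 2 + 4 * (C + M) / μhat)
    (hB : B = (μ / 2 + (C + M * C₂)) * ‖p‖ ^ 2 + (M + L * (C₂ + 1)) * ‖p‖)
    (hB1 : B ≤ 1) (hBδ₁ : B < δ₁) (hBδ' : B < δ') (hBφ : B * (1 + ‖vbar‖ + ρ / 2) < δ')
    (hCδ : C₂ * ‖p‖ < δ₁) (hμC : μ * (C₂ * ‖p‖) ≤ 1) :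
    ∃ d : X, ‖d‖ ≤ C₂ * ‖p‖ ∧ ‖y + D d - cbar‖ ≤ B ∧
      |φ (y + D d) - φ cbar| ≤ B * (1 + ‖vbar‖ + ρ / 2) ∧
      ∀ᶠ d' in 𝓝 d, φ (y + D d) + μ / 2 * ‖d‖ ^ 2 ≤ φ (y + D d') + μ / 2 * ‖d'‖ ^ 2 := by
  have hμ0 : 0 < μ := hμhat.trans_le hμ
  have hL0 : 0 ≤ L := (norm_nonneg D).trans hL
  have hb0 := norm_nonneg vbar
  have hα0 : 0 < α := by rw [hα]; positivity
  have hp0 := norm_nonneg p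
  set S : Set (X × Y) := Metric.closedBall 0 δ₁ ×ˢ Metric.closedBall cbar δ₁ with hS
  have hSc : IsCompact S := (isCompact_closedBall _ _).prod (isCompact_closedBall _ _)
  have h0S : (p, cbar) ∈ S :=
    ⟨mem_closedBall_zero_iff.2 hpδ, Metric.mem_closedBall_self hδ₁.le⟩
  obtain ⟨⟨d, z⟩, ⟨hd, hz⟩, hmin⟩ := LowerSemicontinuousOn.exists_isMinOn ⟨_, h0S⟩ hSc
    (f := fun q : X × Y => φ q.2 + (μ / 2 * ‖q.1‖ ^ 2 + α * ‖q.2 - (y + D q.1)‖)) (by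
      refine LowerSemicontinuousOn.add ?_ (ContinuousOn.lowerSemicontinuousOn ?_)
      · exact (hlsc.comp continuous_snd).lowerSemicontinuousOn S
      · exact Continuous.continuousOn (by fun_prop))
  have hmin' : ∀ d' z', ‖d'‖ ≤ δ₁ → dist z' cbar ≤ δ₁ →
      φ z + (μ / 2 * ‖d‖ ^ 2 + α * ‖z - (y + D d)‖) ≤
        φ z' + (μ / 2 * ‖d'‖ ^ 2 + α * ‖z' - (y + D d')‖) := fun d' z' h1 h2 =>
    hmin (show (d', z') ∈ S from ⟨mem_closedBall_zero_iff.2 h1, h2⟩)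
  clear hmin
  have hd : ‖d‖ ≤ δ₁ := mem_closedBall_zero_iff.1 hd
  have hzd : ‖z - cbar‖ ≤ δ₁ := by rw [← dist_eq_norm]; exact hz
  obtain ⟨hdC, hznorm, hEC, hFC⟩ := penalized_step_bounds (hquad z hz) hM hρ hL hp hvbar hp1 hρδ
    hμhat hμ hρμ (by rw [hα]; linarith) hC hC₂ hd hzd
    (hmin' p cbar hpδ (by rw [dist_self]; exact hδ₁.le))
  have hC0 : 0 ≤ C := by rw [hC]; positivity
  have hC₂0 : 0 ≤ C₂ := by rw [hC₂]; positivity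
  have hB0 : 0 ≤ B := by rw [hB]; positivity
  have hppsq : ‖p‖ ^ 2 ≤ ‖p‖ := by
    rw [sq]; exact mul_le_of_le_one_right hp0 hp1
  have hzB : ‖z - cbar‖ ≤ B := by
    have h1 := mul_le_mul_of_nonneg_left hppsq hM
    have h2 := mul_le_mul_of_nonneg_left (add_le_add hdC le_rfl : ‖d‖ + ‖p‖ ≤ C₂ * ‖p‖ + ‖p‖) hL0
    rw [hB]
    linarith
  have hφB : |φ z - φ cbar| ≤ B * (1 + ‖vbar‖ + ρ / 2) := by
    have hpp : 0 ≤ M * C₂ * ‖p‖ ^ 2 + (M + L * (C₂ + 1)) * ‖p‖ := by positivity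
    have h1 : 0 ≤ B * (‖vbar‖ + ρ / 2) := by positivity
    have h2 := hquad z hz
    have h3 := neg_le_of_abs_le (abs_real_inner_le_norm vbar (z - cbar))
    have h4 := mul_le_mul_of_nonneg_left hzB hb0
    have h5 : ρ / 2 * ‖z - cbar‖ ^ 2 ≤ ρ / 2 * B := by
      refine mul_le_mul_of_nonneg_left ?_ (by positivity)
      calc ‖z - cbar‖ ^ 2 ≤ B ^ 2 := pow_le_pow_left₀ (norm_nonneg _) hzB 2
        _ ≤ B := by rw [sq]; exact mul_le_of_le_one_right hB0 hB1
    rw [abs_le]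
    constructor
    · linarith
    · have : φ z - φ cbar ≤ B := by rw [hB]; linarith
      linarith
  have hdlt : ‖d‖ < δ₁ := hdC.trans_lt hCδ
  have hzlt : dist z cbar < δ₁ := by rw [dist_eq_norm]; exact hzB.trans_lt hBδ₁
  have hdnear : ∀ᶠ d' in 𝓝 d, ‖d'‖ ≤ δ₁ := by
    filter_upwards [continuous_norm.continuousAt.eventually (gt_mem_nhds hdlt)] with d' h
    exact h.le
  have hznear : ∀ᶠ z' in 𝓝 z, dist z' cbar ≤ δ₁ := by
    filter_upwards [Metric.isOpen_ball.mem_nhds (Metric.mem_ball.2 hzlt)] with z' h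
    exact (Metric.mem_ball.1 h).le
  have hzeq : z = y + D d := by
    by_contra hne
    have hE : 0 < ‖z - (y + D d)‖ := norm_pos_iff.2 (sub_ne_zero.2 hne)
    set E := ‖z - (y + D d)‖ with hEdef
    -- The norm penalty is replaced by a quadratic majorant with equality when `‖w‖ = E`, so the
    -- minimizer stays a minimizer and stationarity can be read off separately in `z` and in `d`.
    have hmaj : ∀ w : Y, α * ‖w‖ ≤ α / E / 2 * ‖w‖ ^ 2 + α * E / 2 := by
      intro w
      have h1 : α * ‖w‖ = α / E * (‖w‖ * E) := by field_simp
      have h2 : α / E / 2 * ‖w‖ ^ 2 + α * E / 2 = α / E * ((‖w‖ ^ 2 + E ^ 2) / 2) := by field_simp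
      rw [h1, h2]
      exact mul_le_mul_of_nonneg_left (by linarith [two_mul_le_add_sq ‖w‖ E]) (by positivity)
    have heq : α * E = α / E / 2 * E ^ 2 + α * E / 2 := by field_simp; ring
    have hv : -((α / E) • (z - (y + D d))) ∈ realRegSubdiff φ z := by
      refine neg_smul_mem_realRegSubdiff ?_
      filter_upwards [hznear] with z' hz'
      have h1 := hmin' d z' hd hz'
      have h2 := hmaj (z' - (y + D d))
      rw [← hEdef]
      linarith
    have hDv : adjoint D (-((α / E) • (z - (y + D d)))) + μ • d = 0 := by
      have hg : HasFDerivAt (fun d' : X => y + D d') D d := D.hasFDerivAt.const_add y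
      have h1 := (hasFDerivAt_penalty (x₀ := 0) (u := 0) (z := z) (κ := α / E) hg).add
        (hasFDerivAt_penalty (x₀ := 0) (u := 0) (z := 0) (κ := μ) (hasFDerivAt_id d))
      have h2 := norm_fderiv_le_of_eventually le_rfl h1 (by
        filter_upwards [hdnear] with d' hd'
        have h1 := hmin' d' z hd' hz
        have h2 := hmaj (z - (y + D d'))
        simp only [Pi.add_apply, inner_zero_left, zero_sub, norm_neg, id, zero_mul, neg_zero,
          zero_add, sub_zero]
        rw [← hEdef]
        linarith)
      rw [← map_add, innerSL_apply_norm, norm_le_zero_iff] at h2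
      have hid : adjoint (ContinuousLinearMap.id ℝ X) d = d :=
        ext_inner_right ℝ fun w => by rw [adjoint_inner_left]; rfl
      simpa [hid] using h2
    have hnorm : ‖-((α / E) • (z - (y + D d)))‖ = α := by
      rw [norm_neg, norm_smul, Real.norm_of_nonneg (by positivity), ← hEdef]
      field_simp
    -- The vector has norm `α = ‖vbar‖ + V + 2`, yet its image under the adjoint is `-(μ • d)`, of
    -- norm at most one, so the multiplier bound would give `α ≤ V`.
    have h1 := hV z (by rw [Metric.mem_ball, dist_eq_norm]; exact hzB.trans_lt hBδ')
      (by rw [Real.dist_eq]; exact hφB.trans_lt hBφ) _ (realRegSubdiff_subset _ _ hv) (by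
        rw [eq_neg_of_add_eq_zero_left hDv, norm_neg, norm_smul, Real.norm_of_nonneg hμ0.le]
        exact (mul_le_mul_of_nonneg_left hdC hμ0.le).trans hμC)
    rw [hnorm, hα] at h1
    linarith
  refine ⟨d, hdC, hzeq ▸ hzB, hzeq ▸ hφB, ?_⟩
  have hcont : Tendsto (fun d' => y + D d') (𝓝 d) (𝓝 z) := by
    rw [hzeq]
    exact (continuous_const.add D.continuous).tendsto d
  filter_upwards [hdnear, hcont.eventually hznear] with d' h1 h2
  have h3 := hmin' d' (y + D d') h1 h2
  rw [← hzeq]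
  rw [← hzeq] at h3
  simpa using h3

open ContinuousLinearMap in
/-- Critical steps with bounded multipliers are unique when the proximal parameter dominates the
curvature. -/
theorem critical_step_unique {y : Y} {D : X →L[ℝ] Y} {d₁ d₂ : X} {v₁ v₂ : Y} {V ρ δ' L μ : ℝ}
    (hq : HasQuadSupport φ cbar V ρ δ') (hρ : 0 ≤ ρ) (hL : ‖D‖ ≤ L) (hμ : ρ * L ^ 2 < μ)
    (hz₁ : y + D d₁ ∈ Metric.ball cbar δ') (hz₂ : y + D d₂ ∈ Metric.ball cbar δ')
    (hφ₁ : φ (y + D d₁) < φ cbar + δ') (hφ₂ : φ (y + D d₂) < φ cbar + δ')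
    (hv₁ : v₁ ∈ realSubdiff φ (y + D d₁)) (hv₂ : v₂ ∈ realSubdiff φ (y + D d₂))
    (hV₁ : ‖v₁‖ ≤ V) (hV₂ : ‖v₂‖ ≤ V) (h₁ : adjoint D v₁ + μ • d₁ = 0)
    (h₂ : adjoint D v₂ + μ • d₂ = 0) : d₁ = d₂ := by
  have a1 := hq _ hz₁ hφ₁ v₁ hv₁ hV₁ _ hz₂
  have a2 := hq _ hz₂ hφ₂ v₂ hv₂ hV₂ _ hz₁
  have e1 : y + D d₂ - (y + D d₁) = -D (d₁ - d₂) := by rw [map_sub]; abel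
  have e2 : y + D d₁ - (y + D d₂) = D (d₁ - d₂) := by rw [map_sub]; abel
  rw [e1, norm_neg, inner_neg_right, ← adjoint_inner_left, eq_neg_of_add_eq_zero_left h₁,
    inner_neg_left, real_inner_smul_left] at a1
  rw [e2, ← adjoint_inner_left, eq_neg_of_add_eq_zero_left h₂, inner_neg_left,
    real_inner_smul_left] at a2
  have h3 : inner ℝ d₁ (d₁ - d₂) - inner ℝ d₂ (d₁ - d₂) = ‖d₁ - d₂‖ ^ 2 := by
    rw [← inner_sub_left, real_inner_self_eq_norm_sq]
  have h4 : ‖D (d₁ - d₂)‖ ^ 2 ≤ L ^ 2 * ‖d₁ - d₂‖ ^ 2 := by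
    rw [← mul_pow]
    exact pow_le_pow_left₀ (norm_nonneg _)
      ((D.le_opNorm _).trans (mul_le_mul_of_nonneg_right hL (norm_nonneg _))) 2
  -- The values of `φ` cancel when the two support inequalities are added; the adjoint equations
  -- turn the inner products into `μ * ‖d₁ - d₂‖ ^ 2`.
  have h5 : μ * ‖d₁ - d₂‖ ^ 2 ≤ ρ * L ^ 2 * ‖d₁ - d₂‖ ^ 2 := by
    have := mul_le_mul_of_nonneg_left h4 hρ
    rw [← h3] at this ⊢
    linarith
  have h6 : ‖d₁ - d₂‖ ^ 2 = 0 := by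
    by_contra hne
    have hpos : 0 < ‖d₁ - d₂‖ ^ 2 := lt_of_le_of_ne (sq_nonneg _) (Ne.symm hne)
    nlinarith
  exact sub_eq_zero.1 (norm_eq_zero.1 (pow_eq_zero_iff two_ne_zero |>.1 h6))

end Steps

/-! ### Exact chain rule under bounded multipliers -/

section Chain

variable {X Y : Type*} [NormedAddCommGroup X] [InnerProductSpace ℝ X] [ProperSpace X]
  [NormedAddCommGroup Y] [InnerProductSpace ℝ Y] [ProperSpace Y] {φ : Y → ℝ}

/-- The chain rule for limiting subgradients, when approximate multipliers are bounded. -/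
theorem exists_multiplier_of_mem_realSubdiff_comp (hlsc : LowerSemicontinuous φ)
    (hbdd : ∃ B, ∀ z, B ≤ φ z) {g : X → Y} {x u : X}
    (hg : ∀ᶠ x' in 𝓝 x, DifferentiableAt ℝ g x') (hg' : ContinuousAt (fderiv ℝ g) x)
    {V ε₀ : ℝ} (hε₀ : 0 < ε₀)
    (hV : ∀ x' ∈ Metric.ball x ε₀, ∀ z ∈ Metric.ball (g x) ε₀, dist (φ z) (φ (g x)) < ε₀ →
      ∀ v ∈ realSubdiff φ z, dist (ContinuousLinearMap.adjoint (fderiv ℝ g x') v) u < ε₀ →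
      ‖v‖ ≤ V)
    (hu : u ∈ realSubdiff (fun x' => φ (g x')) x) :
    ∃ v ∈ realSubdiff φ (g x), ContinuousLinearMap.adjoint (fderiv ℝ g x) v = u := by
  obtain ⟨xs, us, h1, h2, h3, h4⟩ := exists_seq_of_mem_realSubdiff hu
  have hgx := (hg.self_of_nhds).continuousAt
  obtain ⟨w, e, hw, he⟩ := exists_seq_of_forall_pos
    (P := fun ε (p : X × Y × Y) => dist p.1 x < ε ∧ dist p.2.1 (g x) < ε ∧
      dist (φ p.2.1) (φ (g x)) < ε ∧ p.2.2 ∈ realRegSubdiff φ p.2.1 ∧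
      dist (ContinuousLinearMap.adjoint (fderiv ℝ g p.1) p.2.2) u < ε ∧ ‖p.2.2‖ ≤ V) (by
    intro ε hε
    obtain ⟨η, hη0, hηε, hηε₀⟩ : ∃ η > 0, η ≤ ε ∧ η ≤ ε₀ :=
      ⟨min ε ε₀, lt_min hε hε₀, min_le_left _ _, min_le_right _ _⟩
    have hη2 : 0 < η / 2 := half_pos hη0
    obtain ⟨j, a1, a2, a3, a4, a5⟩ := ((Metric.tendsto_nhds.1 h1 _ hη2).and
      ((Metric.tendsto_nhds.1 (hgx.tendsto.comp h1) _ hη2).and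
      ((Metric.tendsto_nhds.1 h2 _ hη2).and ((Metric.tendsto_nhds.1 h4 _ hη2).and
      (h1.eventually (eventually_eventually_nhds.2 hg)))))).exists
    obtain ⟨x', z', v, b1, b2, b3, b4, b5⟩ :=
      exists_approx_of_mem_realRegSubdiff_comp hlsc hbdd a5 (h3 j) hη2
    have c1 : dist x' x < η := by linarith [dist_triangle x' (xs j) x]
    have c2 : dist z' (g x) < η := by
      simp only [Function.comp] at a2
      linarith [dist_triangle z' (g (xs j)) (g x)]
    have c3 : dist (φ z') (φ (g x)) < η := by
      linarith [dist_triangle (φ z') (φ (g (xs j))) (φ (g x))]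
    have c5 : dist (ContinuousLinearMap.adjoint (fderiv ℝ g x') v) u < η := by
      linarith [dist_triangle (ContinuousLinearMap.adjoint (fderiv ℝ g x') v) (us j) u]
    exact ⟨(x', z', v), c1.trans_le hηε, c2.trans_le hηε, c3.trans_le hηε, b4,
      c5.trans_le hηε, hV x' (c1.trans_le hηε₀) z' (c2.trans_le hηε₀) (c3.trans_le hηε₀) v
        (realRegSubdiff_subset _ _ b4) (c5.trans_le hηε₀)⟩)
  have hA : ContinuousAt (fun x' => ContinuousLinearMap.adjoint (fderiv ℝ g x')) x :=
    (ContinuousLinearMap.adjoint (𝕜 := ℝ) (E := X) (F := Y)).continuous.continuousAt.comp hg'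
  obtain ⟨v, hv, hAv, -⟩ := exists_subseq_tendsto_multiplier hA (xs := fun j => (w j).1)
    (zs := fun j => (w j).2.1) (vs := fun j => (w j).2.2)
    (tendsto_of_dist_lt (fun j => (hw j).1) he) (tendsto_of_dist_lt (fun j => (hw j).2.1) he)
    (tendsto_of_dist_lt (fun j => (hw j).2.2.1) he)
    (fun j => realRegSubdiff_subset _ _ (hw j).2.2.2.1) (fun j => (hw j).2.2.2.2.2)
    (tendsto_of_dist_lt (fun j => (hw j).2.2.2.2.1) he)
  exact ⟨v, hv, hAv⟩

end Chain

/-! ### Removing the proximal quadratic -/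

section SumRule

variable {k : ℕ} {f : Euc k → EReal}

theorem coe_sub_le_of_le_add_coe {y : EReal} {a b : ℝ} (h : (a : EReal) ≤ y + (b : EReal)) :
    ((a - b : ℝ) : EReal) ≤ y := by
  induction y with
  | bot => simp at h
  | coe y =>
    rw [← EReal.coe_add, EReal.coe_le_coe_iff] at h
    exact EReal.coe_le_coe_iff.2 (by linarith)
  | top => exact le_top

theorem sub_smul_mem_regularSubdiff {μ : ℝ} {d v : Euc k}
    (hv : v ∈ regularSubdiff (fun d => f d + ((μ / 2 * ‖d‖ ^ 2 : ℝ) : EReal)) d) :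
    v - μ • d ∈ regularSubdiff f d := by
  obtain ⟨h1, h2, h3⟩ := hv
  have ht : f d ≠ ⊤ := fun h => h1 (by simp only [h, EReal.top_add_coe])
  have hb : f d ≠ ⊥ := fun h => h2 (by simp only [h, EReal.bot_add])
  refine ⟨ht, hb, fun ε hε => ?_⟩
  obtain ⟨t, ht'⟩ : ∃ t : ℝ, f d = t := ⟨_, (EReal.coe_toReal ht hb).symm⟩
  have hlim : Tendsto (fun d' => μ / 2 * ‖d' - d‖) (𝓝 d) (𝓝 0) := by
    have : Continuous fun d' => μ / 2 * ‖d' - d‖ := by fun_prop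
    simpa using this.tendsto d
  filter_upwards [h3 (ε / 2) (half_pos hε), hlim.eventually (gt_mem_nhds (half_pos hε))]
    with d' a1 a2
  rw [ht', ← EReal.coe_add, ← EReal.coe_add] at a1
  rw [ht', ← EReal.coe_add]
  refine le_trans (EReal.coe_le_coe_iff.2 ?_) (coe_sub_le_of_le_add_coe a1)
  have e : ‖d'‖ ^ 2 = ‖d‖ ^ 2 + 2 * inner ℝ d (d' - d) + ‖d' - d‖ ^ 2 := by
    rw [← norm_add_sq_real, add_sub_cancel]
  rw [e, inner_sub_left, real_inner_smul_left]
  nlinarith [mul_le_mul_of_nonneg_right a2.le (norm_nonneg (d' - d))]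

theorem sub_smul_mem_subdiff {μ : ℝ} {d v : Euc k}
    (hv : v ∈ subdiff (fun d => f d + ((μ / 2 * ‖d‖ ^ 2 : ℝ) : EReal)) d) :
    v - μ • d ∈ subdiff f d := by
  obtain ⟨h1, h2, zs, vs, hz, hf, hmem, hvs⟩ := hv
  have ht : f d ≠ ⊤ := fun h => h1 (by simp only [h, EReal.top_add_coe])
  have hb : f d ≠ ⊥ := fun h => h2 (by simp only [h, EReal.bot_add])
  refine ⟨ht, hb, zs, fun j => vs j - μ • zs j, hz, ?_,
    fun j => sub_smul_mem_regularSubdiff (hmem j), hvs.sub (hz.const_smul μ)⟩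
  have hq : Tendsto (fun j => ((-(μ / 2 * ‖zs j‖ ^ 2) : ℝ) : EReal)) atTop
      (𝓝 ((-(μ / 2 * ‖d‖ ^ 2) : ℝ) : EReal)) :=
    EReal.tendsto_coe.2 (((hz.norm.pow 2).const_mul (μ / 2)).neg)
  -- Addition in `EReal` is continuous here because the second summand is finite; adding the negated
  -- quadratic recovers convergence of `f`.
  have hsum := (EReal.continuousAt_add
    (p := (f d + ((μ / 2 * ‖d‖ ^ 2 : ℝ) : EReal), ((-(μ / 2 * ‖d‖ ^ 2) : ℝ) : EReal)))
    (Or.inr (EReal.coe_ne_bot _)) (Or.inr (EReal.coe_ne_top _))).tendsto.comp (hf.prodMk_nhds hq)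
  have e : ∀ (y : EReal) (a : ℝ), y + (a : EReal) + ((-a : ℝ) : EReal) = y := by
    intro y a
    rw [EReal.coe_neg, ← sub_eq_add_neg, EReal.add_sub_cancel_right]
  simpa only [Function.comp_def, e] using hsum

theorem zero_mem_subdiff_of_isLocalMin {d : Euc k} (hmin : IsLocalMin f d) (ht : f d ≠ ⊤)
    (hb : f d ≠ ⊥) : (0 : Euc k) ∈ subdiff f d := by
  refine ⟨ht, hb, fun _ => d, fun _ => 0, tendsto_const_nhds, tendsto_const_nhds,
    fun _ => ⟨ht, hb, fun ε hε => ?_⟩, tendsto_const_nhds⟩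
  filter_upwards [hmin] with d' hd'
  refine le_trans ?_ hd'
  calc f d + ((inner ℝ (0 : Euc k) (d' - d) - ε * ‖d' - d‖ : ℝ) : EReal) ≤ f d + (0 : ℝ) := by
        refine add_le_add_right (EReal.coe_le_coe_iff.2 ?_) _
        rw [inner_zero_left, zero_sub]
        exact neg_nonpos.2 (by positivity)
    _ = f d := by rw [EReal.coe_zero, add_zero]

end SumRule

/-! ### Smoothness estimates and the convex case -/

/-- First-order estimates for a function that is `C²` at a point. -/
theorem exists_c2_bounds {X Y : Type*} [NormedAddCommGroup X] [NormedSpace ℝ X]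
    [NormedAddCommGroup Y] [NormedSpace ℝ Y] {c : X → Y} {xbar : X}
    (hc : ContDiffAt ℝ 2 c xbar) :
    ∃ L M : ℝ, 0 ≤ M ∧ ∀ᶠ x in 𝓝 xbar, DifferentiableAt ℝ c x ∧ ‖fderiv ℝ c x‖ ≤ L ∧
      ‖fderiv ℝ c x - fderiv ℝ c xbar‖ ≤ M * ‖xbar - x‖ ∧
      ‖c x + fderiv ℝ c x (xbar - x) - c xbar‖ ≤ M * ‖xbar - x‖ ^ 2 := by
  have hf : ContDiffAt ℝ 1 (fderiv ℝ c) xbar := hc.fderiv_right (by norm_num)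
  obtain ⟨K, t, ht, hK⟩ := hf.exists_lipschitzOnWith
  have hdiff : ∀ᶠ x in 𝓝 xbar, DifferentiableAt ℝ c x :=
    (hc.eventually (by simp)).mono fun x hx => hx.differentiableAt (by norm_num)
  obtain ⟨r, hr, hball⟩ := Metric.eventually_nhds_iff_ball.1 (hdiff.and ht)
  refine ⟨‖fderiv ℝ c xbar‖ + 1, K, K.2, ?_⟩
  have hL : ∀ᶠ x in 𝓝 xbar, ‖fderiv ℝ c x‖ < ‖fderiv ℝ c xbar‖ + 1 :=
    hf.continuousAt.norm.eventually (gt_mem_nhds (lt_add_one _))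
  filter_upwards [hL, Metric.ball_mem_nhds xbar hr] with x h1 hx
  have hxb := Metric.mem_ball_self (x := xbar) hr
  refine ⟨(hball x hx).1, h1.le, ?_, ?_⟩
  · have := hK.dist_le_mul x (hball x hx).2 xbar (hball xbar hxb).2
    rwa [dist_eq_norm, dist_eq_norm, norm_sub_rev x] at this
  · have hseg : segment ℝ x xbar ⊆ Metric.ball xbar r :=
      (convex_ball xbar r).segment_subset hx hxb
    have := (convex_segment x xbar).norm_image_sub_le_of_norm_hasFDerivWithin_le'
      (f := c) (f' := fderiv ℝ c) (φ := fderiv ℝ c x) (C := K * ‖xbar - x‖)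
      (fun ξ hξ => (hball ξ (hseg hξ)).1.hasFDerivAt.hasFDerivWithinAt)
      (fun ξ hξ => by
        have h2 := hK.dist_le_mul ξ (hball ξ (hseg hξ)).2 x (hball x hx).2
        rw [dist_eq_norm, dist_eq_norm] at h2
        exact h2.trans (mul_le_mul_of_nonneg_left (norm_sub_le_of_mem_segment hξ) K.2))
      (left_mem_segment ℝ x xbar) (right_mem_segment ℝ x xbar)
    rw [← norm_neg, sq, ← mul_assoc]
    have e : -(c x + fderiv ℝ c x (xbar - x) - c xbar) =
        c xbar - c x - fderiv ℝ c x (xbar - x) := by abel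
    rwa [e]

theorem continuousAt_adjDeriv {n m : ℕ} {c : Euc n → Euc m} {xbar : Euc n}
    (hc : ContDiffAt ℝ 2 c xbar) : ContinuousAt (adjDeriv c) xbar := by
  have hf : ContDiffAt ℝ 1 (fderiv ℝ c) xbar := hc.fderiv_right (by norm_num)
  exact (ContinuousLinearMap.adjoint (𝕜 := ℝ) (E := Euc n)
    (F := Euc m)).continuous.continuousAt.comp hf.continuousAt

theorem IsProxTruncation.eventually_eq_min {k : ℕ} {h : Euc k → EReal} {φ : Euc k → ℝ}
    {β δ : ℝ} {cbar z : Euc k}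
    (heq : ∀ z ∈ Metric.ball cbar δ, (φ z : EReal) = min (h z) β) (hz : z ∈ Metric.ball cbar δ) :
    ∀ᶠ z' in 𝓝 z, (φ z' : EReal) = min (h z') β := by
  filter_upwards [Metric.isOpen_ball.mem_nhds hz] with z' hz'
  exact heq z' hz'

/-- For convex functions the quadratic support inequality holds without curvature. -/
theorem IsProxTruncation.exists_quadSupport_zero {k : ℕ} {h : Euc k → EReal} {φ : Euc k → ℝ}
    {β K δ : ℝ} {cbar : Euc k} (hφ : IsProxTruncation φ cbar β K δ)
    (heq : ∀ z ∈ Metric.ball cbar δ, (φ z : EReal) = min (h z) β)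
    (hconv : Convex ℝ (epigraph h)) {V : ℝ} (hV : 0 ≤ V) :
    ∃ δ' > 0, HasQuadSupport φ cbar V 0 δ' := by
  have hgap : 0 < β - φ cbar := sub_pos.2 hφ.lt
  obtain ⟨δ', hδ'0, h1, h2⟩ : ∃ δ' > 0, δ' ≤ δ ∧ δ' * (1 + 2 * (V + 1)) ≤ β - φ cbar := by
    refine ⟨min δ ((β - φ cbar) / (1 + 2 * (V + 1))), lt_min hφ.pos (by positivity),
      min_le_left _ _, ?_⟩
    rw [← le_div_iff₀ (by positivity)]
    exact min_le_right _ _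
  refine ⟨δ', hδ'0, HasQuadSupport.of_regular fun z hz hzφ v hv hvV z' hz' => ?_⟩
  have hδV : 0 ≤ δ' * (V + 1) := by positivity
  have hzβ : φ z < β := by linarith
  have hzδ := Metric.ball_subset_ball h1 hz
  have hev := eventually_eq_min heq hzδ
  rw [zero_div, zero_mul, sub_zero]
  -- At truncated points convexity of `h` says nothing about `φ`; there the choice of `δ'` keeps the
  -- affine minorant below `β`.
  rcases (hφ.le z').eq_or_lt with h3 | h3
  · have hw : ‖z' - z‖ ≤ 2 * δ' := by
      rw [← dist_eq_norm]
      have a1 := Metric.mem_ball.1 hz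
      have a2 := Metric.mem_ball.1 hz'
      linarith [dist_triangle_right z' z cbar]
    have h4 := real_inner_le_norm v (z' - z)
    have h5 := mul_le_mul hvV.le hw (norm_nonneg _) (by linarith)
    rw [h3]
    linarith
  · rw [← regularSubdiff_eq_real hev hzβ] at hv
    exact le_of_mem_regularSubdiff_of_convex hconv hv
      (coe_eq_of_lt_of_eq_min hev.self_of_nhds hzβ)
      (coe_eq_of_lt_of_eq_min (heq z' (Metric.ball_subset_ball h1 hz')) h3).le

/-! ### Sequences of critical steps -/

section Sequences

variable {n m : ℕ} {h : Euc m → EReal} {c : Euc n → Euc m} {xbar : Euc n} {φ : Euc m → ℝ}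
  {β K δ V δ' : ℝ}

theorem hasFDerivAt_linearization (c : Euc n → Euc m) (x d : Euc n) :
    HasFDerivAt (linearization c x) (fderiv ℝ c x) d :=
  (fderiv ℝ c x).hasFDerivAt.const_add (c x)

theorem fderiv_linearization (c : Euc n → Euc m) (x : Euc n) :
    fderiv ℝ (linearization c x) = fun _ => fderiv ℝ c x :=
  funext fun d => (hasFDerivAt_linearization c x d).fderiv

/-- Critical step sequences have bounded multipliers. -/
theorem IsCriticalStepSeq.exists_multiplier
    (hφ : IsProxTruncation φ (c xbar) β K δ)
    (heq : ∀ z ∈ Metric.ball (c xbar) δ, (φ z : EReal) = min (h z) β)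
    (hc : ContDiffAt ℝ 2 c xbar) (hδ' : 0 < δ')
    (hV : ∀ x ∈ Metric.ball xbar δ', ∀ z ∈ Metric.ball (c xbar) δ',
      dist (φ z) (φ (c xbar)) < δ' → ∀ v ∈ realSubdiff φ z, ‖adjDeriv c x v‖ ≤ 1 → ‖v‖ ≤ V)
    {μ : ℕ → ℝ} {x d : ℕ → Euc n} (hμ : ∀ r, 0 < μ r) (hx : Tendsto x atTop (𝓝 xbar))
    (hμx : Tendsto (fun r => μ r * ‖x r - xbar‖) atTop (𝓝 0))
    (hd : IsCriticalStepSeq h c xbar μ x d) :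
    Tendsto (fun r => linearization c (x r) (d r)) atTop (𝓝 (c xbar)) ∧
    Tendsto (fun r => φ (linearization c (x r) (d r))) atTop (𝓝 (φ (c xbar))) ∧
    Tendsto (fun r => μ r • d r) atTop (𝓝 0) ∧
    ∀ᶠ r in atTop, ∃ v ∈ realSubdiff φ (linearization c (x r) (d r)),
      adjDeriv c (x r) v + μ r • d r = 0 ∧ ‖v‖ ≤ V := by
  obtain ⟨hcrit, hO, hh⟩ := hd
  have hf : ContDiffAt ℝ 1 (fderiv ℝ c) xbar := hc.fderiv_right (by norm_num)
  have hx0 : Tendsto (fun r => x r - xbar) atTop (𝓝 0) := by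
    simpa using hx.sub_const xbar
  have hd0 : Tendsto d atTop (𝓝 0) := hO.trans_tendsto hx0
  have hl : Tendsto (fun r => linearization c (x r) (d r)) atTop (𝓝 (c xbar)) := by
    have h1 := (hc.continuousAt.tendsto.comp hx).add
      (tendsto_clm_apply (hf.continuousAt.tendsto.comp hx) hd0)
    rw [map_zero, add_zero] at h1
    exact h1
  have hev := IsProxTruncation.eventually_eq_min heq (Metric.mem_ball_self hφ.pos)
  have hφl := (tendsto_truncation_iff hev hφ.lt hl).1 hh
  have hμd : Tendsto (fun r => μ r • d r) atTop (𝓝 0) := by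
    obtain ⟨C, hC⟩ := hO.bound
    refine squeeze_zero_norm' ?_ (by simpa using hμx.const_mul C)
    filter_upwards [hC] with r hr
    rw [norm_smul, Real.norm_of_nonneg (hμ r).le]
    linarith [mul_le_mul_of_nonneg_left hr (hμ r).le]
  refine ⟨hl, hφl, hμd, ?_⟩
  -- Half of each margin is reserved for the chain-rule neighbourhood: with the step data within `δ'
  -- / 2` and `‖μ r • d r‖ < 1 / 2`, the approximations still meet the multiplier bound's hypotheses
  -- with `δ'` and `1`.
  obtain ⟨ε, hε, hε1, hε2⟩ : ∃ ε > 0, ε ≤ δ' / 2 ∧ ε ≤ 1 / 2 :=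
    ⟨min (δ' / 2) (1 / 2), lt_min (half_pos hδ') (by norm_num), min_le_left _ _,
      min_le_right _ _⟩
  have hμdn := hμd.norm
  rw [norm_zero] at hμdn
  filter_upwards [hcrit, hx.eventually (Metric.ball_mem_nhds _ hδ'),
    hl.eventually (Metric.ball_mem_nhds _ hφ.pos), hl.eventually (Metric.ball_mem_nhds _ hε),
    hφl.eventually (gt_mem_nhds hφ.lt), Metric.tendsto_nhds.1 hφl ε hε,
    hμdn.eventually (gt_mem_nhds (half_pos one_pos))] with r a1 a2 a3 a4 a5 a6 a7
  have hcont : Continuous (linearization c (x r)) :=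
    continuous_const.add (fderiv ℝ c (x r)).continuous
  have b1 := sub_smul_mem_subdiff a1
  rw [zero_sub, subdiff_eq_real (ψ := fun d => φ (linearization c (x r) d)) (β := β)
    (hcont.continuousAt.eventually (IsProxTruncation.eventually_eq_min heq a3)) a5] at b1
  have b2 : ‖-(μ r • d r)‖ < 1 / 2 := by rwa [norm_neg]
  obtain ⟨v, hv, hAv⟩ := exists_multiplier_of_mem_realSubdiff_comp hφ.lsc hφ.bdd
    (Eventually.of_forall fun d => (hasFDerivAt_linearization c (x r) d).differentiableAt)
    (by rw [fderiv_linearization]; exact continuousAt_const) hε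
    (V := V) (by
      intro x' _ z hz hφz v hv hdist
      rw [fderiv_linearization] at hdist
      refine hV (x r) a2 z ?_ ?_ v hv ?_
      · have := Metric.mem_ball.1 hz
        have := Metric.mem_ball.1 a4
        exact Metric.mem_ball.2 (by
          linarith [dist_triangle z (linearization c (x r) (d r)) (c xbar)])
      · linarith [dist_triangle (φ z) (φ (linearization c (x r) (d r))) (φ (c xbar))]
      · have e := norm_le_norm_add_norm_sub' (adjDeriv c (x r) v) (-(μ r • d r))
        rw [dist_eq_norm] at hdist
        have : ‖adjDeriv c (x r) v - -(μ r • d r)‖ < ε := hdist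
        linarith) b1
  rw [fderiv_linearization] at hAv
  have hAv' : adjDeriv c (x r) v = -(μ r • d r) := hAv
  refine ⟨v, hv, by rw [hAv', neg_add_cancel], hV (x r) a2 _ ?_ (by linarith) v hv ?_⟩
  · exact Metric.ball_subset_ball (by linarith) a4
  · rw [hAv']; linarith

/-- Keeping the curvature `ρ` as a parameter lets the prox-regular and the convex case share one
proof: the threshold depends on the support inequality only through `8 * ρ * L ^ 2 ≤ μhat`. -/
theorem UniqueStepProperty.of_quadSupport
    (hφ : IsProxTruncation φ (c xbar) β K δ)
    (heq : ∀ z ∈ Metric.ball (c xbar) δ, (φ z : EReal) = min (h z) β)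
    (hc : ContDiffAt ℝ 2 c xbar) (hV0 : 0 ≤ V) (hδ' : 0 < δ')
    (hV : ∀ x ∈ Metric.ball xbar δ', ∀ z ∈ Metric.ball (c xbar) δ',
      dist (φ z) (φ (c xbar)) < δ' → ∀ v ∈ realSubdiff φ z, ‖adjDeriv c x v‖ ≤ 1 → ‖v‖ ≤ V)
    {vbar : Euc m} (hvbar : vbar ∈ realSubdiff φ (c xbar)) (hAvbar : adjDeriv c xbar vbar = 0)
    (huniq : ∀ v ∈ realSubdiff φ (c xbar), adjDeriv c xbar v = 0 → v = vbar)
    {ρ δq : ℝ} (hρ : 0 ≤ ρ) (hδq : 0 < δq) (hq : HasQuadSupport φ (c xbar) V ρ δq)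
    {L : ℝ} (hL : ∀ᶠ x in 𝓝 xbar, ‖fderiv ℝ c x‖ ≤ L) {μhat : ℝ} (hμhat : 0 < μhat)
    (hρμ : 8 * ρ * L ^ 2 ≤ μhat) : UniqueStepProperty h c xbar vbar μhat := by
  intro μ x hμ hx hμx
  have hμ0 : ∀ r, 0 < μ r := fun r => hμhat.trans (hμ r)
  have hL0 : 0 ≤ L := (norm_nonneg _).trans hL.self_of_nhds
  have hev := IsProxTruncation.eventually_eq_min heq (Metric.mem_ball_self hφ.pos)
  have hvV : ‖vbar‖ ≤ V := hV xbar (Metric.mem_ball_self hδ') _ (Metric.mem_ball_self hδ')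
    (by rwa [dist_self]) vbar hvbar (by rw [hAvbar, norm_zero]; exact zero_le_one)
  obtain ⟨_, M₀, hM₀, hc2⟩ := exists_c2_bounds hc
  obtain ⟨M, hM⟩ : ∃ M, M = M₀ * (‖vbar‖ + 1) := ⟨_, rfl⟩
  -- A single `M` serves both the linearization error, at most `M₀ * ‖p‖ ^ 2`, and the residual of
  -- `vbar` in the adjoint equation, at most `M₀ * ‖vbar‖ * ‖p‖`.
  have hM0 : 0 ≤ M := by rw [hM]; positivity
  obtain ⟨δ₁, hδ₁, hδ₁q, hρδ⟩ : ∃ δ₁ > 0, δ₁ < δq ∧ 2 * ρ * (δ₁ * (1 + L)) < 1 := by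
    refine ⟨min (δq / 2) (1 / (2 * (2 * ρ + 1) * (1 + L))), lt_min (half_pos hδq)
      (by positivity), (min_le_left _ _).trans_lt (half_lt_self hδq), ?_⟩
    have h1 : min (δq / 2) (1 / (2 * (2 * ρ + 1) * (1 + L))) * (1 + L) ≤
        1 / (2 * (2 * ρ + 1)) := by
      calc _ ≤ 1 / (2 * (2 * ρ + 1) * (1 + L)) * (1 + L) :=
            mul_le_mul_of_nonneg_right (min_le_right _ _) (by positivity)
        _ = _ := by field_simp
    calc _ ≤ 2 * ρ * (1 / (2 * (2 * ρ + 1))) := mul_le_mul_of_nonneg_left h1 (by positivity)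
      _ < 1 := by
        rw [mul_one_div, div_lt_one (by positivity)]
        linarith
  obtain ⟨α, hα⟩ : ∃ α, α = ‖vbar‖ + V + 2 := ⟨_, rfl⟩
  obtain ⟨C, hC⟩ : ∃ C, C = (α + ‖vbar‖ + 1) * M + 2 * ρ * M ^ 2 + 2 * ρ * L ^ 2 := ⟨_, rfl⟩
  obtain ⟨C₂, hC₂⟩ : ∃ C₂, C₂ = 2 + 4 * (C + M) / μhat := ⟨_, rfl⟩
  obtain ⟨ε, hε⟩ : ∃ ε : ℕ → ℝ, ε = fun r => ‖xbar - x r‖ := ⟨_, rfl⟩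
  have hεx : ∀ r, ‖xbar - x r‖ = ε r := fun r => by rw [hε]
  have hε0 : Tendsto ε atTop (𝓝 0) := by
    rw [hε]; simpa using (hx.const_sub xbar).norm
  have hμε : Tendsto (fun r => μ r * ε r) atTop (𝓝 0) := by
    rw [hε]; simpa only [norm_sub_rev xbar] using hμx
  obtain ⟨B, hB⟩ : ∃ B : ℕ → ℝ, B = fun r =>
    (μ r / 2 + (C + M * C₂)) * ε r ^ 2 + (M + L * (C₂ + 1)) * ε r := ⟨_, rfl⟩
  -- `μ r` may be unbounded, so the first term is written as `(μ r * ε r) * ε r`.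
  have hB0 : Tendsto B atTop (𝓝 0) := by
    have h1 := (((hμε.mul hε0).div_const 2).add ((hε0.pow 2).const_mul (C + M * C₂))).add
      (hε0.const_mul (M + L * (C₂ + 1)))
    rw [hB]
    convert h1 using 2
    · ring
    · norm_num
  have hBφ : Tendsto (fun r => B r * (1 + ‖vbar‖ + ρ / 2)) atTop (𝓝 0) := by
    simpa using hB0.mul_const (1 + ‖vbar‖ + ρ / 2)
  have hCε : Tendsto (fun r => C₂ * ε r) atTop (𝓝 0) := by simpa using hε0.const_mul C₂
  have hμCε : Tendsto (fun r => μ r * (C₂ * ε r)) atTop (𝓝 0) := by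
    have := hμε.const_mul C₂
    rw [mul_zero] at this
    exact this.congr fun r => by ring
  have hρε : Tendsto (fun r => 2 * ρ * (δ₁ + M * ε r ^ 2 + L * (δ₁ + ε r))) atTop
      (𝓝 (2 * ρ * (δ₁ * (1 + L)))) := by
    have := ((((hε0.pow 2).const_mul M).const_add δ₁).add
      ((hε0.const_add δ₁).const_mul L)).const_mul (2 * ρ)
    convert this using 2
    ring
  have hex : ∀ᶠ r in atTop, ∃ d : Euc n, ‖d‖ ≤ C₂ * ε r ∧
      ‖c (x r) + fderiv ℝ c (x r) d - c xbar‖ ≤ B r ∧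
      |φ (c (x r) + fderiv ℝ c (x r) d) - φ (c xbar)| ≤ B r * (1 + ‖vbar‖ + ρ / 2) ∧
      ∀ᶠ d' in 𝓝 d, φ (c (x r) + fderiv ℝ c (x r) d) + μ r / 2 * ‖d‖ ^ 2 ≤
        φ (c (x r) + fderiv ℝ c (x r) d') + μ r / 2 * ‖d'‖ ^ 2 := by
    filter_upwards [hx.eventually hc2, hx.eventually hL,
      hx.eventually (Metric.ball_mem_nhds _ hδ'), hε0.eventually (gt_mem_nhds one_pos),
      hε0.eventually (gt_mem_nhds hδ₁), hρε.eventually (gt_mem_nhds hρδ),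
      hB0.eventually (gt_mem_nhds one_pos), hB0.eventually (gt_mem_nhds hδ₁),
      hB0.eventually (gt_mem_nhds hδ'), hBφ.eventually (gt_mem_nhds hδ'),
      hCε.eventually (gt_mem_nhds hδ₁), hμCε.eventually (gt_mem_nhds one_pos)]
      with r ⟨_, _, b1, b2⟩ a2 a3 a4 a5 a6 a7 a8 a9 a10 a11 a12
    have hMM : M₀ ≤ M := by
      rw [hM]; exact le_mul_of_one_le_right hM₀ (by linarith [norm_nonneg vbar])
    -- Since the adjoint derivative at `xbar` kills `vbar`, only the Lipschitz difference of
    -- derivatives remains.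
    have hvb : ‖ContinuousLinearMap.adjoint (fderiv ℝ c (x r)) vbar‖ ≤ M * ‖xbar - x r‖ := by
      have e : ContinuousLinearMap.adjoint (fderiv ℝ c (x r)) vbar =
          ContinuousLinearMap.adjoint (fderiv ℝ c (x r) - fderiv ℝ c xbar) vbar := by
        have h0 : ContinuousLinearMap.adjoint (fderiv ℝ c xbar) vbar = 0 := hAvbar
        rw [map_sub, sub_apply, h0, sub_zero]
      rw [e]
      refine (ContinuousLinearMap.le_opNorm _ _).trans ?_
      rw [LinearIsometryEquiv.norm_map]
      refine (mul_le_mul_of_nonneg_right b1 (norm_nonneg _)).trans ?_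
      rw [hM]
      have : 0 ≤ M₀ * ‖xbar - x r‖ := by positivity
      linarith
    have hres := exists_local_min_step (φ := φ) (cbar := c xbar) (vbar := vbar) hφ.lsc
      (y := c (x r)) (D := fderiv ℝ c (x r)) (p := xbar - x r) (μ := μ r) (μhat := μhat)
      (α := α) (M := M) (L := L) (ρ := ρ) (C := C) (C₂ := C₂) (B := B r) (δ₁ := δ₁) (δ' := δ')
      (V := V)
      (fun z hz => hq _ (Metric.mem_ball_self hδq) (by linarith) vbar hvbar hvV z
        (Metric.closedBall_subset_ball hδ₁q hz))
      (hV (x r) a3) hM0 hρ a2 hV0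
      (b2.trans (mul_le_mul_of_nonneg_right hMM (sq_nonneg _))) hvb
    rw [hεx r] at hres
    exact hres a4.le a5.le hδ₁ a6.le hμhat (hμ r).le (hρμ.trans (hμ r).le) hα hC hC₂
      (by rw [hB]) a7.le a8 a9 a10 a11 a12.le
  obtain ⟨d, hd⟩ := hex.choice
  have hl : Tendsto (fun r => linearization c (x r) (d r)) atTop (𝓝 (c xbar)) :=
    tendsto_iff_norm_sub_tendsto_zero.2 (squeeze_zero' (Eventually.of_forall fun _ => norm_nonneg _)
      (hd.mono fun r hr => hr.2.1) hB0)
  have hφl : Tendsto (fun r => φ (linearization c (x r) (d r))) atTop (𝓝 (φ (c xbar))) :=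
    tendsto_iff_norm_sub_tendsto_zero.2 (squeeze_zero' (Eventually.of_forall fun _ => norm_nonneg _)
      (hd.mono fun r hr => hr.2.2.1) hBφ)
  have hloc : ∀ᶠ r in atTop, IsLocalMin (proxObjective h c (x r) (μ r)) (d r) ∧
      (0 : Euc n) ∈ subdiff (proxObjective h c (x r) (μ r)) (d r) := by
    filter_upwards [hd, hl.eventually (Metric.ball_mem_nhds _ hφ.pos),
      hφl.eventually (gt_mem_nhds hφ.lt)] with r ⟨_, _, _, a1⟩ a2 a3
    have hval := coe_eq_of_lt_of_eq_min (heq _ a2) a3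
    have hcont : Continuous (linearization c (x r)) :=
      continuous_const.add (fderiv ℝ c (x r)).continuous
    have hmin : IsLocalMin (proxObjective h c (x r) (μ r)) (d r) := by
      filter_upwards [a1, hcont.continuousAt.eventually
        (IsProxTruncation.eventually_eq_min heq a2)] with d' b1 b2
      simp only [proxObjective]
      rw [hval, ← EReal.coe_add]
      refine (EReal.coe_le_coe_iff.2 b1).trans ?_
      rw [EReal.coe_add]
      refine add_le_add_left ?_ _
      exact b2.le.trans (min_le_left _ _)
    refine ⟨hmin, zero_mem_subdiff_of_isLocalMin hmin ?_ ?_⟩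
    · simp only [proxObjective]
      rw [hval, ← EReal.coe_add]
      exact EReal.coe_ne_top _
    · simp only [proxObjective]
      rw [hval, ← EReal.coe_add]
      exact EReal.coe_ne_bot _
  have hcrit : IsCriticalStepSeq h c xbar μ x d := by
    refine ⟨hloc.mono fun r hr => hr.2, IsBigO.of_bound C₂ ?_,
      (tendsto_truncation_iff hev hφ.lt hl).2 hφl⟩
    filter_upwards [hd] with r hr
    rw [norm_sub_rev, hεx]
    exact hr.1
  -- Treating the constructed steps as an arbitrary critical sequence gives their multipliers the
  -- same bound `V` as those of any competitor, as the uniqueness argument requires.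
  obtain ⟨-, -, hμd, hmul⟩ := hcrit.exists_multiplier hφ heq hc hδ' hV hμ0 hx hμx
  obtain ⟨v, hv⟩ := hmul.choice
  refine ⟨d, v, hloc.mono fun r hr => hr.1, hcrit, ?_, ?_, fun d' hd' => ?_⟩
  · filter_upwards [hv, hl.eventually (Metric.ball_mem_nhds _ hφ.pos),
      hφl.eventually (gt_mem_nhds hφ.lt)] with r a1 a2 a3
    refine ⟨a1.2.1, ?_⟩
    rw [subdiff_eq_real (IsProxTruncation.eventually_eq_min heq a2) a3]
    exact a1.1
  · refine multiplier_close (continuousAt_adjDeriv hc) hδ' hV huniq hx hl hφl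
      (hv.mono fun r hr => hr.1) ?_
    have hneg := hμd.neg
    rw [neg_zero] at hneg
    exact hneg.congr' (hv.mono fun r hr => (eq_neg_of_add_eq_zero_left hr.2.1).symm)
  · obtain ⟨hl', hφl', -, hmul'⟩ := hd'.exists_multiplier hφ heq hc hδ' hV hμ0 hx hμx
    have hlt : φ (c xbar) < φ (c xbar) + δq := lt_add_of_pos_right _ hδq
    filter_upwards [hv, hmul', hx.eventually hL, hl.eventually (Metric.ball_mem_nhds _ hδq),
      hl'.eventually (Metric.ball_mem_nhds _ hδq), hφl.eventually (gt_mem_nhds hlt),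
      hφl'.eventually (gt_mem_nhds hlt)] with r a1 ⟨v', a2, a2', a2''⟩ a3 a4 a5 a6 a7
    have hρL : 0 ≤ ρ * L ^ 2 := by positivity
    exact critical_step_unique hq hρ a3 (by linarith [hμ r] : ρ * L ^ 2 < μ r) a5 a4 a7 a6
      a2 a1.1 a2'' a1.2.2 a2' a1.2.1

/-- The criticality condition produces a multiplier. -/
theorem exists_multiplier_of_critical (hφ : IsProxTruncation φ (c xbar) β K δ)
    (heq : ∀ z ∈ Metric.ball (c xbar) δ, (φ z : EReal) = min (h z) β)
    (hc : ContDiffAt ℝ 2 c xbar) (hδ' : 0 < δ')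
    (hV : ∀ x ∈ Metric.ball xbar δ', ∀ z ∈ Metric.ball (c xbar) δ',
      dist (φ z) (φ (c xbar)) < δ' → ∀ v ∈ realSubdiff φ z, ‖adjDeriv c x v‖ ≤ 1 → ‖v‖ ≤ V)
    (hcrit : (0 : Euc n) ∈ subdiff (fun x => h (c x)) xbar) :
    ∃ v ∈ realSubdiff φ (c xbar), adjDeriv c xbar v = 0 := by
  have hf : ContDiffAt ℝ 1 (fderiv ℝ c) xbar := hc.fderiv_right (by norm_num)
  rw [subdiff_eq_real (ψ := fun x => φ (c x)) (β := β) (hc.continuousAt.eventually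
    (IsProxTruncation.eventually_eq_min heq (Metric.mem_ball_self hφ.pos))) hφ.lt] at hcrit
  refine exists_multiplier_of_mem_realSubdiff_comp hφ.lsc hφ.bdd
    ((hc.eventually (by simp)).mono fun x hx => hx.differentiableAt (by norm_num))
    hf.continuousAt (V := V) (ε₀ := min δ' 1) (lt_min hδ' one_pos) ?_ hcrit
  intro x hx z hz hφz v hv hdist
  rw [dist_zero_right] at hdist
  exact hV x (Metric.ball_subset_ball (min_le_left _ _) hx) z
    (Metric.ball_subset_ball (min_le_left _ _) hz) (hφz.trans_le (min_le_left _ _)) v hv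
    (hdist.le.trans (min_le_right _ _))

end Sequences

end ProxLin

/-! ### Assembly -/

theorem mainTheorem5 {n m : ℕ} (h : ProxLin.Euc m → EReal) (c : ProxLin.Euc n → ProxLin.Euc m)
    (xbar : ProxLin.Euc n)
    (hc : ContDiffAt ℝ 2 c xbar)
    (hprox : ProxLin.ProxRegularAt h (c xbar))
    (hcrit : (0 : ProxLin.Euc n) ∈ ProxLin.subdiff (fun x => h (c x)) xbar)
    (hne : (ProxLin.subdiff h (c xbar)).Nonempty)
    (hli : ∀ w ∈ ProxLin.par (ProxLin.subdiff h (c xbar)),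
      ProxLin.adjDeriv c xbar w = 0 → w = 0) :
    ∃ vbar : ProxLin.Euc m,
      {v | v ∈ ProxLin.subdiff h (c xbar) ∧ ProxLin.adjDeriv c xbar v = 0} = {vbar} ∧
      (∃ μhat : ℝ, 0 ≤ μhat ∧ ProxLin.UniqueStepProperty h c xbar vbar μhat) ∧
      ((∀ z, h z ≠ ⊥) → Convex ℝ (ProxLin.epigraph h) → LowerSemicontinuous h →
        ∀ μhat : ℝ, 0 < μhat → ProxLin.UniqueStepProperty h c xbar vbar μhat) := by
  obtain ⟨φ, β, K, δ, hφ, heq⟩ := hprox.exists_truncation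
  have hsub := ProxLin.subdiff_eq_real
    (ProxLin.IsProxTruncation.eventually_eq_min heq (Metric.mem_ball_self hφ.pos)) hφ.lt
  rw [hsub] at hne hli ⊢
  -- Transversality is used only on differences of two subgradients, which lie in the parallel
  -- subspace.
  have hli' : ∀ v₁ ∈ ProxLin.realSubdiff φ (c xbar), ∀ v₂ ∈ ProxLin.realSubdiff φ (c xbar),
      ProxLin.adjDeriv c xbar (v₁ - v₂) = 0 → v₁ = v₂ := fun v₁ h₁ v₂ h₂ h0 =>
    sub_eq_zero.1 (hli _ (AffineSubspace.vsub_mem_direction (subset_affineSpan ℝ _ h₁)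
      (subset_affineSpan ℝ _ h₂)) h0)
  obtain ⟨V, hV0, δ', hδ', hV⟩ :=
    hφ.exists_multiplier_bound (ProxLin.continuousAt_adjDeriv hc) hne hli'
  obtain ⟨vbar, hvbar, hAvbar⟩ :=
    ProxLin.exists_multiplier_of_critical hφ heq hc hδ' hV hcrit
  have huniq : ∀ v ∈ ProxLin.realSubdiff φ (c xbar), ProxLin.adjDeriv c xbar v = 0 →
      v = vbar := fun v hv hAv => hli' v hv vbar hvbar (by rw [map_sub, hAv, hAvbar, sub_zero])
  obtain ⟨L, _, _, hc2⟩ := ProxLin.exists_c2_bounds hc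
  have hL : ∀ᶠ x in 𝓝 xbar, ‖fderiv ℝ c x‖ ≤ L := hc2.mono fun x hx => hx.2.1
  refine ⟨vbar, ?_, ?_, fun _ hconv _ μhat hμhat => ?_⟩
  · ext v
    exact ⟨fun hv => huniq v hv.1 hv.2, fun hv => by
      rw [Set.mem_singleton_iff.1 hv]; exact ⟨hvbar, hAvbar⟩⟩
  · obtain ⟨ρ, hρ, δq, hδq, hq⟩ := hφ.exists_quadSupport hV0
    have hnn : 0 ≤ 8 * ρ * L ^ 2 := by positivity
    -- The curvature depends on the multiplier bound `V`, so the threshold is chosen last; the added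
    -- `1` keeps it positive, since the step constants divide by it.
    exact ⟨8 * ρ * L ^ 2 + 1, by linarith, .of_quadSupport hφ heq hc hV0 hδ' hV hvbar hAvbar
      huniq hρ hδq hq hL (by linarith) (by linarith)⟩
  -- With zero curvature the threshold condition is vacuous for every positive `μhat`.
  · obtain ⟨δq, hδq, hq⟩ := hφ.exists_quadSupport_zero heq hconv hV0
    exact .of_quadSupport hφ heq hc hV0 hδ' hV hvbar hAvbar huniq le_rfl hδq hq hL hμhat
      (by rw [mul_zero, zero_mul]; exact hμhat.le)
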